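/- Let $d\in\mathbb N$, let $g:\mathbb R\to\mathbb R$ and $f:\mathbb T^d\to\mathbb R$, $\mathbb T=\mathbb R/2\pi\mathbb Z$, be real analytic, and let $\omega\in\mathbb R^d$ be an arbitrary frequency vector (no Diophantine or non-resonance condition). Consider, for a real parameter $\varepsilon$, the equation $$\varepsilon\ddot x+\dot x+\varepsilon g(x)=\varepsilon f(\omega t).\qquad(*)$$ Let $f_\nu=(2\pi)^{-d}\int_{[0,2\pi]^d}f(\psi)e^{-i\nu\cdot\psi}\,d\psi$, $\nu\in\mathbb Z^d$, be the Fourier coefficients of $f$, and let $f_0:=\sum_{\nu\in\mathbb Z^d,\ \omega\cdot\nu=0}f_\nu$ be the constant term of the quasi-periodic function $t\mapsto f(\omega t)$; if the components of $\omega$ are rationally independent, $f_0$ is simply the Fourier coefficient with index $\nu=0$. Assume that $c_0\in\mathbb R$ is a simple zero of $g(x)-f_0$, that is $g(c_0)=f_0$ and $g'(c_0)\neq0$. Then there exist $\varepsilon_0>0$ and functions $X(\cdot,\varepsilon):\mathbb T^d\to\mathbb R$ such that: (1) for every $|\varepsilon|<\varepsilon_0$ the function $\psi\mapsto X(\psi,\varepsilon)$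 is real analytic on $\mathbb T^d$ and $x_0(t)=c_0+X(\omega t,\varepsilon)$ is a solution of $(*)$ on $\mathbb R$; (2) $X(\psi,\varepsilon)\to0$ as $\varepsilon\to0$, uniformly in $\psi$; (3) if in addition $g'(c_0)>0$, there is $\rho>0$, independent of $\varepsilon$, such that, with $B_\rho=\{(x,y)\in\mathbb R^2:|x-c_0|<\rho,\ |y|<\rho\}$: (a) for $0<\varepsilon<\varepsilon_0$ the solution $x_0$ is locally attractive in the plane $(x,\dot x)$: it is Lyapunov stable (uniformly in the initial time), and for every $t_0\in\mathbb R$ every initial datum $(x(t_0),\dot x(t_0))\in B_\rho$ gives rise to a solution $x$ of $(*)$ for all $t\ge t_0$, which satisfies $x(t)-x_0(t)\to0$ and $\dot x(t)-\dot x_0(t)\to0$ as $t\to+\infty$; (b) for $0<|\varepsilon|<\varepsilon_0$ the solution $x_0$ is unique near $(c_0,0)$: one has $(x_0(t),\dot x_0(t))\in B_\rho$ for all $t\in\mathbb R$, and $x_0$ is the only solution of $(*)$ on $\mathbb R$ with $(x(t),\dot x(t))\in B_\rho$ for all $t\in\mathbb R$. -/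

import Mathlib

open Set Filter Topology MeasureTheory

noncomputable section

/-- The scalar product `ω · ν` of a frequency vector and an integer vector. -/
def freqDot {d : ℕ} (ω : Fin d → ℝ) (ν : Fin d → ℤ) : ℝ :=
  ∑ i, ω i * (ν i : ℝ)

/-- A function on `ℝ^d` which is `2π`-periodic in each variable, i.e. a function on the
torus `𝕋^d = (ℝ / 2πℤ)^d`. -/
def TorusPeriodic {d : ℕ} (F : (Fin d → ℝ) → ℝ) : Prop :=
  ∀ (ψ : Fin d → ℝ) (ν : Fin d → ℤ), F (fun i => ψ i + 2 * Real.pi * (ν i : ℝ)) = F ψ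

/-- Real analytic functions on the torus `𝕋^d`. -/
def TorusAnalytic {d : ℕ} (F : (Fin d → ℝ) → ℝ) : Prop :=
  AnalyticOnNhd ℝ F univ ∧ TorusPeriodic F

/-- The Fourier coefficient `F_ν = (2π)^{-d} ∫_{[0,2π]^d} F(ψ) e^{-i ν·ψ} dψ`. -/
def torusFourierCoeff {d : ℕ} (F : (Fin d → ℝ) → ℝ) (ν : Fin d → ℤ) : ℂ :=
  ((2 * Real.pi) ^ d : ℂ)⁻¹ *
    ∫ ψ in Icc (0 : Fin d → ℝ) (fun _ => 2 * Real.pi),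
      (F ψ : ℂ) * Complex.exp (-Complex.I * (freqDot ψ ν : ℂ))

/-- The constant term `f₀` of the quasi-periodic function `t ↦ f(ω t)`: the sum of the Fourier
coefficients `f_ν` of `f` over all integer vectors `ν` with `ω · ν = 0`. If the components of `ω`
are rationally independent, only `ν = 0` contributes (`meanValue_eq_of_nonresonant`). If not, this
is the zeroth Fourier coefficient that one finds after rewriting `f(ω t)` with a rationally
independent frequency vector. The sum is a real number because `f` is real-valued. -/
def meanValue {d : ℕ} (f : (Fin d → ℝ) → ℝ) (ω : Fin d → ℝ) : ℝ :=
  (∑' ν : {ν : Fin d → ℤ // freqDot ω ν = 0}, torusFourierCoeff f ν.1).re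

theorem meanValue_eq_of_nonresonant {d : ℕ} (f : (Fin d → ℝ) → ℝ) (ω : Fin d → ℝ)
    (hω : ∀ ν : Fin d → ℤ, freqDot ω ν = 0 → ν = 0) :
    meanValue f ω = (torusFourierCoeff f 0).re := by
  have h0 : freqDot ω (0 : Fin d → ℤ) = 0 := by simp [freqDot]
  unfold meanValue
  rw [tsum_eq_single (⟨0, h0⟩ : {ν : Fin d → ℤ // freqDot ω ν = 0})]
  intro ν hν
  exact absurd (Subtype.ext (hω ν.1 ν.2)) hν

/-- `c` is a simple zero of `h`. -/
def IsSimpleZero (h : ℝ → ℝ) (c : ℝ) : Prop :=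
  h c = 0 ∧ deriv h c ≠ 0

/-- On the time interval `J` the function `x` is twice differentiable with velocity `v`, and
`ε ẍ + ẋ + ε g(x) = ε f(ω t)`. -/
def IsSolutionOn {d : ℕ} (ε : ℝ) (g : ℝ → ℝ) (f : (Fin d → ℝ) → ℝ) (ω : Fin d → ℝ)
    (J : Set ℝ) (x v : ℝ → ℝ) : Prop :=
  ∀ t ∈ J, HasDerivWithinAt x (v t) J t ∧
    ∃ a : ℝ, HasDerivWithinAt v a J t ∧ ε * a + v t + ε * g (x t) = ε * f (t • ω)

/-- The motion `t ↦ c₀ + X(ω t)`. -/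
def responseMotion {d : ℕ} (c₀ : ℝ) (X : (Fin d → ℝ) → ℝ) (ω : Fin d → ℝ) (t : ℝ) : ℝ :=
  c₀ + X (t • ω)

/-- Lyapunov stability in the plane `(x, ẋ)` of the motion `x₀`, uniformly in the initial time. -/
def IsLyapunovStable {d : ℕ} (ε : ℝ) (g : ℝ → ℝ) (f : (Fin d → ℝ) → ℝ) (ω : Fin d → ℝ)
    (x₀ : ℝ → ℝ) : Prop :=
  ∀ η > 0, ∃ δ > 0, ∀ (t₀ : ℝ) (x v : ℝ → ℝ), IsSolutionOn ε g f ω (Ici t₀) x v →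
    |x t₀ - x₀ t₀| < δ → |v t₀ - deriv x₀ t₀| < δ →
      ∀ t ≥ t₀, |x t - x₀ t| < η ∧ |v t - deriv x₀ t| < η

/-- Every initial datum `(x₁, v₁)` with `|x₁ - c₀| < ρ` and `|v₁| < ρ`, given at any time `t₀`,
launches a solution for all `t ≥ t₀`, and every such solution is asymptotic to the motion `x₀` in
the plane `(x, ẋ)`. -/
def AttractsBox {d : ℕ} (ε : ℝ) (g : ℝ → ℝ) (f : (Fin d → ℝ) → ℝ) (ω : Fin d → ℝ)
    (x₀ : ℝ → ℝ) (c₀ ρ : ℝ) : Prop :=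
  ∀ t₀ x₁ v₁ : ℝ, |x₁ - c₀| < ρ → |v₁| < ρ →
    (∃ x v : ℝ → ℝ, IsSolutionOn ε g f ω (Ici t₀) x v ∧ x t₀ = x₁ ∧ v t₀ = v₁) ∧
    ∀ x v : ℝ → ℝ, IsSolutionOn ε g f ω (Ici t₀) x v → x t₀ = x₁ → v t₀ = v₁ →
      Tendsto (fun t => x t - x₀ t) atTop (𝓝 0) ∧
      Tendsto (fun t => v t - deriv x₀ t) atTop (𝓝 0)

/-- The trajectory of `x₀` in the plane `(x, ẋ)` lies in the box `|x - c₀| < ρ`, `|ẋ| < ρ`, and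
`x₀` is the only solution on the whole line whose trajectory stays in that box. -/
def UniqueInBox {d : ℕ} (ε : ℝ) (g : ℝ → ℝ) (f : (Fin d → ℝ) → ℝ) (ω : Fin d → ℝ)
    (x₀ : ℝ → ℝ) (c₀ ρ : ℝ) : Prop :=
  (∀ t, |x₀ t - c₀| < ρ ∧ |deriv x₀ t| < ρ) ∧
    ∀ x v : ℝ → ℝ, IsSolutionOn ε g f ω univ x v →
      (∀ t, |x t - c₀| < ρ ∧ |v t| < ρ) → x = x₀

end

/-!
For `y = x - c₀` and `a = g'(c₀)` the equation with `ε ≠ 0` reads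
`(d/dt - l₁) (d/dt - l₂) y = f(ω t) - f₀ - N(y)`, where `N` is the nonlinear remainder of `g` at
`c₀` and `l₁ + l₂ = -1 / ε`, `l₁ l₂ = a`: there is a slow root `l₁ ≈ -ε a` and a fast root
`l₂ ≈ -1 / ε`. On the bounded functions the operator on the left has an inverse of norm at most
`|a|⁻¹`, uniformly in `ε`, so for `N` with a small Lipschitz constant the contraction principle
gives exactly one bounded solution. Its size is controlled by the response of the linear oscillator
to the forcing. The response to a single mode `e^{ibt}` with `b ≠ 0` is `O(|b|⁻¹ |l₂|⁻¹)` because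
the mode is the derivative of a bounded function; as the response to a mode is also at most `|a|⁻¹`
times its amplitude and the Fourier series of `f` converges absolutely, dominated convergence shows
that the response to all of `f(ω t) - f₀` tends to `0`, and small divisors play no role.

Everything commutes with translations in time, so the solution is `X(ω t)` for the function `X` on
the torus that evaluates at time `0` the response to `t ↦ f(ψ + ω t)`. The latter depends
analytically on `ψ` as an element of the space of bounded functions, hence so does `X`, by the
analytic inverse function theorem there.

If `a > 0` and `ε > 0`, both roots are negative, and the decay of the solutions of the two
first-order factors gives the exponential decay of the difference of two solutions.
-/

noncomputable section

open scoped BoundedContinuousFunction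

section FirstOrder

theorem abs_le_exp_mul_add_div {l C t₀ t₁ : ℝ} {y z : ℝ → ℝ} (hl : l < 0)
    (hy : ∀ t ∈ Icc t₀ t₁, HasDerivWithinAt y (l * y t + z t) (Icc t₀ t₁) t)
    (hz : ∀ t ∈ Icc t₀ t₁, |z t| ≤ C) {t : ℝ} (ht : t ∈ Icc t₀ t₁) :
    |y t| ≤ Real.exp (l * (t - t₀)) * |y t₀| + C / -l := by
  have hE (c s : ℝ) :
      HasDerivAt (fun s => Real.exp (c * (s - t₀))) (Real.exp (c * (s - t₀)) * c) s := by
    simpa using! (((hasDerivAt_id s).sub_const t₀).const_mul c).exp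
  have hbound := image_norm_le_of_norm_deriv_right_le_deriv_boundary
    (f := fun s => Real.exp (-l * (s - t₀)) * y s) (f' := fun s => Real.exp (-l * (s - t₀)) * z s)
    (B := fun s => |y t₀| + C / -l * (Real.exp (-l * (s - t₀)) - 1))
    (B' := fun s => C * Real.exp (-l * (s - t₀)))
    (HasDerivWithinAt.continuousOn fun s hs => (hE (-l) s).hasDerivWithinAt.mul (hy s hs))
    (fun s hs => by
      have h := (hE (-l) s).hasDerivWithinAt.mul
        ((hy s ⟨hs.1, hs.2.le⟩).mono_of_mem_nhdsWithin (Icc_mem_nhdsGE_of_mem hs))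
      exact h.congr_deriv (by ring))
    (by simp)
    (fun s => ((((hE (-l) s).sub_const 1).const_mul (C / -l)).const_add _).congr_deriv
      (by have := hl.ne; field_simp))
    (fun s hs => by
      rw [norm_mul, Real.norm_of_nonneg (Real.exp_nonneg _), mul_comm]
      exact mul_le_mul_of_nonneg_right (hz s ⟨hs.1, hs.2.le⟩) (Real.exp_nonneg _))
    ht
  rw [norm_mul, Real.norm_of_nonneg (Real.exp_nonneg _), Real.norm_eq_abs] at hbound
  have hC : 0 ≤ C / -l := div_nonneg ((abs_nonneg _).trans (hz t ht)) (neg_nonneg.2 hl.le)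
  have hinv : Real.exp (l * (t - t₀)) * Real.exp (-l * (t - t₀)) = 1 := by
    rw [← Real.exp_add]; simp
  calc |y t| = Real.exp (l * (t - t₀)) * (Real.exp (-l * (t - t₀)) * |y t|) := by
        rw [← mul_assoc, hinv, one_mul]
    _ ≤ Real.exp (l * (t - t₀)) * (|y t₀| + C / -l * (Real.exp (-l * (t - t₀)) - 1)) :=
        mul_le_mul_of_nonneg_left hbound (Real.exp_nonneg _)
    _ = Real.exp (l * (t - t₀)) * |y t₀| + C / -l
          - C / -l * Real.exp (l * (t - t₀)) := by linear_combination (C / -l) * hinv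
    _ ≤ _ := sub_le_self _ (mul_nonneg hC (Real.exp_nonneg _))

theorem abs_le_div_of_bounded_of_neg {l B C : ℝ} {y z : ℝ → ℝ} (hl : l < 0)
    (hy : ∀ t, HasDerivAt y (l * y t + z t) t) (hB : ∀ t, |y t| ≤ B) (hz : ∀ t, |z t| ≤ C)
    (t : ℝ) : |y t| ≤ C / -l := by
  have hlim : Tendsto (fun s : ℝ => Real.exp (l * s) * B + C / -l) atTop (𝓝 (0 * B + C / -l)) :=
    ((Real.tendsto_exp_atBot.comp (tendsto_id.const_mul_atTop_of_neg hl)).mul_const B).add_const _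
  rw [zero_mul, zero_add] at hlim
  refine ge_of_tendsto hlim ((eventually_ge_atTop 0).mono fun s hs => ?_)
  have h := abs_le_exp_mul_add_div (t₀ := t - s) (t₁ := t) hl
    (fun u _ => (hy u).hasDerivWithinAt) (fun u _ => hz u) (right_mem_Icc.2 (by linarith))
  rw [sub_sub_cancel] at h
  exact h.trans (by gcongr; exact hB _)

theorem abs_le_div_of_bounded {l B C : ℝ} {y z : ℝ → ℝ} (hl : l ≠ 0)
    (hy : ∀ t, HasDerivAt y (l * y t + z t) t) (hB : ∀ t, |y t| ≤ B) (hz : ∀ t, |z t| ≤ C)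
    (t : ℝ) : |y t| ≤ C / |l| := by
  rcases hl.lt_or_gt with hneg | hpos
  · rw [abs_of_neg hneg]
    exact abs_le_div_of_bounded_of_neg hneg hy hB hz t
  · have hy' (s : ℝ) : HasDerivAt (fun s => y (-s)) (-l * y (-s) + -z (-s)) s := by
      have h : HasDerivAt (fun s => y (-s)) ((l * y (-s) + z (-s)) * -1) s :=
        (hy (-s)).comp s (hasDerivAt_neg s)
      exact h.congr_deriv (by ring)
    have h := abs_le_div_of_bounded_of_neg (neg_neg_of_pos hpos) hy' (fun s => hB (-s))
      (fun s => (abs_neg (z (-s))).trans_le (hz (-s))) (-t)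
    rwa [neg_neg, neg_neg, ← abs_of_pos hpos] at h

end FirstOrder

section Resolvent

/-- The integral formula for the resolvent `(d/dt - l)⁻¹` on bounded continuous functions. One
formula serves both signs of `l`: the substitution `v = l s` turns it into an integral of
`e^{l (t - s)} F s` over the half-line on which the exponential decays. For `l = 0` it is the junk
value `0`. -/
def derivResolventFun (l : ℝ) (F : ℝ →ᵇ ℝ) (t : ℝ) : ℝ :=
  -l⁻¹ * (Real.exp (l * t) * ∫ v in Ioi (l * t), Real.exp (-v) * F (v / l))

theorem integrableOn_exp_neg_mul (l : ℝ) (F : ℝ →ᵇ ℝ) (c : ℝ) :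
    IntegrableOn (fun v => Real.exp (-v) * F (v / l)) (Ioi c) :=
  (integrableOn_exp_neg_Ioi c).mul_bdd (c := ‖F‖)
    (F.continuous.comp (continuous_id.div_const l)).aestronglyMeasurable
    (Eventually.of_forall fun _ => F.norm_coe_le_norm _)

theorem hasDerivAt_integral_Ioi {φ : ℝ → ℝ} (hφ : Continuous φ)
    (hint : ∀ c, IntegrableOn φ (Ioi c)) (x : ℝ) :
    HasDerivAt (fun x => ∫ v in Ioi x, φ v) (-φ x) x := by
  have h : (fun x => ∫ v in Ioi x, φ v) = fun x => (∫ v in Ioi 0, φ v) - ∫ v in 0..x, φ v := by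
    ext x
    rw [← intervalIntegral.integral_interval_add_Ioi (hint 0) (hint x), add_sub_cancel_left]
  rw [h]
  exact (hφ.integral_hasStrictDerivAt 0 x).hasDerivAt.const_sub _

theorem hasDerivAt_derivResolventFun (l : ℝ) (F : ℝ →ᵇ ℝ) (t : ℝ) :
    HasDerivAt (derivResolventFun l F)
      (l * derivResolventFun l F t + l⁻¹ * l * F (l * t / l)) t := by
  have hφ : Continuous fun v => Real.exp (-v) * F (v / l) := by fun_prop
  have hlin : HasDerivAt (fun t => l * t) l t := by simpa using! (hasDerivAt_id t).const_mul l
  have h := (hlin.exp.mul ((hasDerivAt_integral_Ioi hφ (integrableOn_exp_neg_mul l F)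
    (l * t)).comp t hlin)).const_mul (-l⁻¹)
  refine h.congr_deriv ?_
  have hexp : Real.exp (l * t) * Real.exp (-(l * t)) = 1 := by rw [← Real.exp_add]; simp
  simp only [derivResolventFun, Function.comp_apply]
  linear_combination (l⁻¹ * l * F (l * t / l)) * hexp

theorem abs_derivResolventFun_le (l : ℝ) (F : ℝ →ᵇ ℝ) (t : ℝ) :
    |derivResolventFun l F t| ≤ |l|⁻¹ * ‖F‖ := by
  have hle : |∫ v in Ioi (l * t), Real.exp (-v) * F (v / l)| ≤ Real.exp (-(l * t)) * ‖F‖ := by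
    have h := norm_integral_le_of_norm_le (f := fun v => Real.exp (-v) * F (v / l))
      ((integrableOn_exp_neg_Ioi (l * t)).mul_const ‖F‖) (Eventually.of_forall fun v => ?_)
    · rwa [integral_mul_const, integral_exp_neg_Ioi] at h
    rw [norm_mul, Real.norm_of_nonneg (Real.exp_nonneg _)]
    exact mul_le_mul_of_nonneg_left (F.norm_coe_le_norm _) (Real.exp_nonneg _)
  have hexp : Real.exp (l * t) * Real.exp (-(l * t)) = 1 := by rw [← Real.exp_add]; simp
  rw [derivResolventFun, abs_mul, abs_neg, abs_inv, abs_mul, abs_of_pos (Real.exp_pos _)]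
  refine mul_le_mul_of_nonneg_left ?_ (by positivity)
  calc _ ≤ Real.exp (l * t) * (Real.exp (-(l * t)) * ‖F‖) :=
        mul_le_mul_of_nonneg_left hle (Real.exp_nonneg _)
    _ = ‖F‖ := by rw [← mul_assoc, hexp, one_mul]

/-- The resolvent `(d/dt - l)⁻¹` on bounded continuous functions, for `l ≠ 0`. -/
def derivResolvent (l : ℝ) : (ℝ →ᵇ ℝ) →L[ℝ] (ℝ →ᵇ ℝ) :=
  LinearMap.mkContinuous
    { toFun := fun F => .ofNormedAddCommGroup (derivResolventFun l F)
        (continuous_iff_continuousAt.2 fun t => (hasDerivAt_derivResolventFun l F t).continuousAt)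
        (|l|⁻¹ * ‖F‖) (abs_derivResolventFun_le l F)
      map_add' := fun F G => by
        ext t
        have h := integral_add (integrableOn_exp_neg_mul l F (l * t))
          (integrableOn_exp_neg_mul l G (l * t))
        simp only [BoundedContinuousFunction.coe_ofNormedAddCommGroup, derivResolventFun,
          BoundedContinuousFunction.coe_add, Pi.add_apply, mul_add, h]
      map_smul' := fun c F => by
        ext t
        simp only [BoundedContinuousFunction.coe_ofNormedAddCommGroup, derivResolventFun,
          BoundedContinuousFunction.coe_smul, smul_eq_mul, mul_left_comm _ c, integral_const_mul,
          RingHom.id_apply] }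
    |l|⁻¹ fun F => BoundedContinuousFunction.norm_ofNormedAddCommGroup_le _ (by positivity)
      (abs_derivResolventFun_le l F)

variable {l : ℝ}

theorem norm_derivResolvent_le (l : ℝ) : ‖derivResolvent l‖ ≤ |l|⁻¹ :=
  LinearMap.mkContinuous_norm_le _ (by positivity) _

theorem hasDerivAt_derivResolvent (hl : l ≠ 0) (F : ℝ →ᵇ ℝ) (t : ℝ) :
    HasDerivAt (derivResolvent l F) (l * derivResolvent l F t + F t) t := by
  have h := hasDerivAt_derivResolventFun l F t
  rwa [inv_mul_cancel₀ hl, one_mul, mul_div_cancel_left₀ _ hl] at h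

theorem eq_derivResolvent_of_hasDerivAt (hl : l ≠ 0) {y F : ℝ →ᵇ ℝ}
    (hy : ∀ t, HasDerivAt y (l * y t + F t) t) : y = derivResolvent l F := by
  ext t
  have hdiff (t : ℝ) : HasDerivAt (y - derivResolvent l F) (l * (y - derivResolvent l F) t + 0) t :=
    ((hy t).sub (hasDerivAt_derivResolvent hl F t)).congr_deriv (by simp; ring)
  have h := abs_le_div_of_bounded hl hdiff (y - derivResolvent l F).norm_coe_le_norm
    (fun _ => abs_zero.le) t
  rw [zero_div] at h
  exact sub_eq_zero.1 (abs_nonpos_iff.1 h)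

theorem derivResolvent_deriv (hl : l ≠ 0) {y y' : ℝ →ᵇ ℝ} (hy : ∀ t, HasDerivAt y (y' t) t) :
    derivResolvent l y' = y + l • derivResolvent l y := by
  refine (eq_derivResolvent_of_hasDerivAt hl fun t => ?_).symm
  refine ((hy t).add ((hasDerivAt_derivResolvent hl y t).const_smul l)).congr_deriv ?_
  simp [mul_add]; ring

theorem norm_derivResolvent_deriv_le (hl : l ≠ 0) {y y' : ℝ →ᵇ ℝ}
    (hy : ∀ t, HasDerivAt y (y' t) t) :
    ‖derivResolvent l y'‖ ≤ 2 * ‖y‖ := by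
  have h : ‖l • derivResolvent l y‖ ≤ ‖y‖ := by
    rw [norm_smul, Real.norm_eq_abs, ← le_inv_mul_iff₀ (abs_pos.2 hl)]
    exact (derivResolvent l).le_of_opNorm_le (norm_derivResolvent_le l) y
  rw [derivResolvent_deriv hl hy, two_mul]
  exact (norm_add_le _ _).trans (by gcongr)

end Resolvent

section Oscillator

/-- On `J`, the function `y` has velocity `w` and `(d/dt - l₁) (d/dt - l₂) y = h`, that is
`y'' = (l₁ + l₂) y' - l₁ l₂ y + h`. -/
def SolvesOscillatorOn (l₁ l₂ : ℝ) (h : ℝ → ℝ) (J : Set ℝ) (y w : ℝ → ℝ) : Prop :=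
  ∀ t ∈ J, HasDerivWithinAt y (w t) J t ∧
    HasDerivWithinAt w ((l₁ + l₂) * w t - l₁ * l₂ * y t + h t) J t

variable {l₁ l₂ : ℝ} {h : ℝ → ℝ} {J : Set ℝ} {y w : ℝ → ℝ}

theorem SolvesOscillatorOn.mono {J' : Set ℝ} (hy : SolvesOscillatorOn l₁ l₂ h J y w)
    (hJ : J' ⊆ J) : SolvesOscillatorOn l₁ l₂ h J' y w :=
  fun t ht => ⟨(hy t (hJ ht)).1.mono hJ, (hy t (hJ ht)).2.mono hJ⟩

theorem solvesOscillatorOn_iff : SolvesOscillatorOn l₁ l₂ h J y w ↔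
    ∀ t ∈ J, HasDerivWithinAt y (l₂ * y t + (w t - l₂ * y t)) J t ∧
      HasDerivWithinAt (fun t => w t - l₂ * y t) (l₁ * (w t - l₂ * y t) + h t) J t := by
  refine forall₂_congr fun t _ => ?_
  rw [add_sub_cancel]
  refine and_congr_right fun hy => ⟨fun hw => (hw.sub (hy.const_mul l₂)).congr_deriv (by ring),
    fun hz => ?_⟩
  have hw : HasDerivWithinAt (fun t => w t - l₂ * y t + l₂ * y t) _ J t :=
    hz.add (hy.const_mul l₂)
  simp only [sub_add_cancel] at hw
  exact hw.congr_deriv (by ring)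

/-- The inverse of `(d/dt - l₁) (d/dt - l₂)` on bounded continuous functions. -/
def oscillatorResponse (l₁ l₂ : ℝ) : (ℝ →ᵇ ℝ) →L[ℝ] (ℝ →ᵇ ℝ) :=
  derivResolvent l₁ ∘L derivResolvent l₂

theorem norm_oscillatorResponse_le (l₁ l₂ : ℝ) : ‖oscillatorResponse l₁ l₂‖ ≤ |l₁ * l₂|⁻¹ := by
  rw [abs_mul, mul_inv]
  exact (ContinuousLinearMap.opNorm_comp_le _ _).trans
    (mul_le_mul (norm_derivResolvent_le l₁) (norm_derivResolvent_le l₂) (norm_nonneg _)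
      (by positivity))

theorem solvesOscillatorOn_oscillatorResponse (hl₁ : l₁ ≠ 0) (hl₂ : l₂ ≠ 0) (h : ℝ →ᵇ ℝ) :
    SolvesOscillatorOn l₁ l₂ h univ (oscillatorResponse l₁ l₂ h)
      (l₁ • oscillatorResponse l₁ l₂ h + derivResolvent l₂ h) := by
  intro t _
  have hy := hasDerivAt_derivResolvent hl₁ (derivResolvent l₂ h) t
  refine ⟨hy.hasDerivWithinAt, HasDerivAt.hasDerivWithinAt ?_⟩
  refine ((hy.const_smul l₁).add (hasDerivAt_derivResolvent hl₂ h t)).congr_deriv ?_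
  simp only [oscillatorResponse, ContinuousLinearMap.comp_apply, smul_eq_mul, Pi.add_apply,
    Pi.smul_apply]
  ring

theorem SolvesOscillatorOn.eq_oscillatorResponse (hl₁ : l₁ ≠ 0) (hl₂ : l₂ ≠ 0)
    {h y w : ℝ →ᵇ ℝ} (hy : SolvesOscillatorOn l₁ l₂ h univ y w) :
    y = oscillatorResponse l₁ l₂ h := by
  have hz : w - l₁ • y = derivResolvent l₂ h := eq_derivResolvent_of_hasDerivAt hl₂ fun t =>
    ((hasDerivWithinAt_univ.1 (hy t trivial).2).sub
      ((hasDerivWithinAt_univ.1 (hy t trivial).1).const_smul l₁)).congr_deriv (by simp; ring)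
  refine eq_derivResolvent_of_hasDerivAt hl₁ fun t => ?_
  refine (hasDerivWithinAt_univ.1 (hy t trivial).1).congr_deriv ?_
  simp [← hz]

theorem norm_oscillatorResponse_deriv_le (hl₁ : l₁ ≠ 0) (hl₂ : l₂ ≠ 0) {y y' : ℝ →ᵇ ℝ}
    (hy : ∀ t, HasDerivAt y (y' t) t) : ‖oscillatorResponse l₁ l₂ y'‖ ≤ 2 * ‖y‖ / |l₂| := by
  have hderiv (t : ℝ) : HasDerivAt (derivResolvent l₂ y) (derivResolvent l₂ y' t) t := by
    refine (hasDerivAt_derivResolvent hl₂ y t).congr_deriv ?_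
    rw [derivResolvent_deriv hl₂ hy]
    simp [add_comm]
  refine (norm_derivResolvent_deriv_le hl₁ hderiv).trans ?_
  rw [mul_div_assoc, div_eq_inv_mul]
  gcongr
  exact (derivResolvent l₂).le_of_opNorm_le (norm_derivResolvent_le l₂) y

end Oscillator

section LipschitzPerturbation

variable {V : Type*} [NormedAddCommGroup V] [NormedSpace ℝ V] {φ : V → V} {K : NNReal}

theorem approximatesLinearOn_id_add (hφ : LipschitzWith K φ) :
    ApproximatesLinearOn (fun x => x + φ x) (ContinuousLinearEquiv.refl ℝ V : V →L[ℝ] V) univ K :=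
  fun x _ y _ => by
    have h : x + φ x - (y + φ y) - (x - y) = φ x - φ y := by abel
    simpa [h] using hφ.norm_sub_le x y

variable [CompleteSpace V]

/-- The homeomorphism `x ↦ x + φ x` for a contraction `φ` of a Banach space. -/
def idAddHomeomorph (hφ : LipschitzWith K φ) (hK : K < 1) : V ≃ₜ V :=
  (approximatesLinearOn_id_add hφ).toHomeomorph _ <| (subsingleton_or_nontrivial V).imp_right
    fun (_ : Nontrivial V) => hK.trans_eq (by rw [ContinuousLinearEquiv.refl_symm,
      ContinuousLinearEquiv.coe_refl, ContinuousLinearMap.nnnorm_id, inv_one])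

theorem idAddHomeomorph_apply (hφ : LipschitzWith K φ) (hK : K < 1) (x : V) :
    idAddHomeomorph hφ hK x = x + φ x := rfl

theorem norm_idAddHomeomorph_symm_le (hφ : LipschitzWith K φ) (hK : K < 1) (h0 : φ 0 = 0) (y : V) :
    ‖(idAddHomeomorph hφ hK).symm y‖ ≤ ‖y‖ / (1 - K) := by
  set x := (idAddHomeomorph hφ hK).symm y
  have hy : y = x + φ x := ((idAddHomeomorph hφ hK).apply_symm_apply y).symm
  have hφx : ‖φ x‖ ≤ K * ‖x‖ := by simpa [h0] using hφ.norm_sub_le x 0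
  rw [le_div_iff₀ (sub_pos.2 (by exact_mod_cast hK)), hy]
  linarith [norm_sub_le_norm_add x (φ x)]

theorem analyticAt_idAddHomeomorph_symm (hφ : LipschitzWith K φ) (hK : K < 1) {y : V}
    (h : AnalyticAt ℝ φ ((idAddHomeomorph hφ hK).symm y)) :
    AnalyticAt ℝ (idAddHomeomorph hφ hK).symm y := by
  set x := (idAddHomeomorph hφ hK).symm y
  have hderiv : HasFDerivAt (fun x => x + φ x) (1 - -fderiv ℝ φ x) x :=
    ((hasFDerivAt_id x).add h.differentiableAt.hasFDerivAt).congr_fderiv (sub_neg_eq_add _ _).symm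
  have hnorm : ‖-fderiv ℝ φ x‖ < 1 := by
    rw [norm_neg]
    exact (h.differentiableAt.hasFDerivAt.le_of_lipschitz hφ).trans_lt (by exact_mod_cast hK)
  let T : V ≃L[ℝ] V := ContinuousLinearEquiv.unitsEquiv ℝ V (Units.oneSub _ hnorm)
  exact ((idAddHomeomorph hφ hK).toOpenPartialHomeomorph.contDiffAt_symm (f₀' := T) (n := ⊤)
    trivial hderiv (analyticAt_id.add h).contDiffAt).analyticAt

end LipschitzPerturbation

section Superposition

theorem radius_le_radius_ofScalars (A : Type*) [NormedRing A] [NormedAlgebra ℝ A] [NormOneClass A]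
    (p : FormalMultilinearSeries ℝ ℝ ℝ) :
    p.radius ≤ (FormalMultilinearSeries.ofScalars A p.coeff).radius :=
  FormalMultilinearSeries.radius_le_of_le fun k => by
    rw [FormalMultilinearSeries.ofScalars_norm, ← p.norm_apply_eq_norm_coef]

variable {α : Type*} [TopologicalSpace α] [Nonempty α] {N : ℝ → ℝ} {K : NNReal}
  {p : FormalMultilinearSeries ℝ ℝ ℝ} {r : ENNReal}

theorem hasFPowerSeriesOnBall_comp (hN : LipschitzWith K N) (hp : HasFPowerSeriesOnBall N p 0 r) :
    HasFPowerSeriesOnBall (BoundedContinuousFunction.comp N hN : (α →ᵇ ℝ) → α →ᵇ ℝ)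
      (FormalMultilinearSeries.ofScalars _ p.coeff) 0 r where
  r_le := hp.r_le.trans (radius_le_radius_ofScalars _ p)
  r_pos := hp.r_pos
  hasSum := fun {y} hy => by
    set q := FormalMultilinearSeries.ofScalars (α →ᵇ ℝ) p.coeff
    have hsum : HasSum (fun k => q k fun _ => y) (q.sum y) :=
      q.hasSum (Metric.eball_subset_eball (hp.r_le.trans (radius_le_radius_ofScalars _ p)) hy)
    convert! hsum using 1
    ext t
    rw [zero_add]
    have hy_t : y t ∈ Metric.eball (0 : ℝ) r := by
      rw [mem_eball_zero_iff] at hy ⊢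
      exact (ENNReal.coe_le_coe.2 (y.nnnorm_coe_le_nnnorm t)).trans_lt hy
    have hN_t := hp.hasSum hy_t
    rw [zero_add] at hN_t
    refine hN_t.unique ?_
    convert! hsum.mapL (BoundedContinuousFunction.evalCLM ℝ t) using 2 with k
    simp [q, FormalMultilinearSeries.ofScalars_apply_eq, mul_comm]

end Superposition

section Mean

theorem exists_eq_one_of_notMem_of_isClosed {V : Type*} [NormedAddCommGroup V] [NormedSpace ℝ V]
    {S : Submodule ℝ V} (hS : IsClosed (S : Set V)) {x : V} (hx : x ∉ S) :
    ∃ m : V →L[ℝ] ℝ, m x = 1 ∧ ∀ y ∈ S, m y = 0 := by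
  obtain ⟨m, u, hu, hm⟩ := geometric_hahn_banach_point_closed S.convex hS hx
  have hS0 (y : V) (hy : y ∈ S) : m y = 0 := by
    by_contra h
    have := hm _ (S.smul_mem (u / m y) hy)
    simp [h] at this
  have h0 := hm 0 S.zero_mem
  rw [map_zero] at h0
  exact ⟨(m x)⁻¹ • m, inv_mul_cancel₀ (hu.trans h0).ne, fun y hy => by simp [hS0 y hy]⟩

open BoundedContinuousFunction in
theorem exists_mean : ∃ m : (ℝ →ᵇ ℝ) →L[ℝ] ℝ, m 1 = 1 ∧
    ∀ y y' : ℝ →ᵇ ℝ, (∀ t, HasDerivAt y (y' t) t) → m y' = 0 := by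
  let D : Submodule ℝ (ℝ →ᵇ ℝ) :=
    { carrier := {y' | ∃ y : ℝ →ᵇ ℝ, ∀ t, HasDerivAt y (y' t) t}
      add_mem' := fun ⟨y, hy⟩ ⟨z, hz⟩ => ⟨y + z, fun t => (hy t).add (hz t)⟩
      zero_mem' := ⟨0, fun t => hasDerivAt_const t 0⟩
      smul_mem' := fun c _ ⟨y, hy⟩ => ⟨c • y, fun t => (hy t).const_smul c⟩ }
  have hone : (1 : ℝ →ᵇ ℝ) ∉ D.topologicalClosure := by
    intro h
    obtain ⟨y', ⟨y, hy⟩, hdist⟩ := Metric.mem_closure_iff.1 h (1 / 2) (by norm_num)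
    have hge (t : ℝ) : 1 / 2 ≤ y' t := by
      have h1 : |1 - y' t| < 1 / 2 := (dist_coe_le_dist t).trans_lt hdist
      linarith [(abs_lt.1 h1).2]
    have hgrowth := mul_sub_le_image_sub_of_le_deriv
      (fun t => (hy t).differentiableAt) (fun t => (hge t).trans_eq (hy t).deriv.symm)
      (x := 0) (y := 4 * ‖y‖ + 2) (by positivity)
    linarith [le_abs_self (y (4 * ‖y‖ + 2)), y.norm_coe_le_norm (4 * ‖y‖ + 2),
      neg_abs_le (y 0), y.norm_coe_le_norm 0, Real.norm_eq_abs (y 0),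
      Real.norm_eq_abs (y (4 * ‖y‖ + 2))]
  obtain ⟨m, hm, hD⟩ :=
    exists_eq_one_of_notMem_of_isClosed D.isClosed_topologicalClosure hone
  exact ⟨m, hm, fun y y' hy => hD y' (D.le_topologicalClosure ⟨y, hy⟩)⟩

/-- A mean on bounded continuous functions: a continuous linear functional which is `1` on the
constant `1` and vanishes on derivatives of bounded functions. It is chosen by the Hahn–Banach
theorem; on uniform limits of trigonometric polynomials it is the constant term. -/
def mean : (ℝ →ᵇ ℝ) →L[ℝ] ℝ := exists_mean.choose

theorem mean_one : mean 1 = 1 := exists_mean.choose_spec.1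

theorem mean_deriv {y y' : ℝ →ᵇ ℝ} (hy : ∀ t, HasDerivAt y (y' t) t) : mean y' = 0 :=
  exists_mean.choose_spec.2 y y' hy

/-- The part `y - mean y` of zero mean. -/
def fluctuation : (ℝ →ᵇ ℝ) →L[ℝ] (ℝ →ᵇ ℝ) :=
  ContinuousLinearMap.id ℝ _ - mean.smulRight 1

theorem fluctuation_apply (y : ℝ →ᵇ ℝ) (t : ℝ) : fluctuation y t = y t - mean y := by
  simp [fluctuation]

theorem fluctuation_one : fluctuation 1 = 0 := by
  ext t; simp [fluctuation_apply, mean_one]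

theorem fluctuation_deriv {y y' : ℝ →ᵇ ℝ} (hy : ∀ t, HasDerivAt y (y' t) t) :
    fluctuation y' = y' := by
  ext t; rw [fluctuation_apply, mean_deriv hy, sub_zero]

end Mean

section Translation

/-- Composition with a fixed continuous map, as a continuous linear map. -/
def pullback {α β : Type*} [TopologicalSpace α] [TopologicalSpace β] (φ : C(α, β)) :
    (β →ᵇ ℝ) →L[ℝ] (α →ᵇ ℝ) :=
  LinearMap.mkContinuous
    { toFun := fun y => y.compContinuous φ
      map_add' := fun _ _ => rfl
      map_smul' := fun _ _ => rfl }
    1 fun y => by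
      rw [one_mul]
      exact (BoundedContinuousFunction.norm_le (norm_nonneg y)).2 fun a => y.norm_coe_le_norm (φ a)

theorem pullback_apply {α β : Type*} [TopologicalSpace α] [TopologicalSpace β] (φ : C(α, β))
    (y : β →ᵇ ℝ) (a : α) : pullback φ y a = y (φ a) := rfl

/-- The translation `y ↦ y (· + s)`. -/
def shift {E : Type*} [TopologicalSpace E] [Add E] [ContinuousAdd E] (s : E) :
    (E →ᵇ ℝ) →L[ℝ] (E →ᵇ ℝ) :=
  pullback (ContinuousMap.addRight s)

theorem shift_apply {E : Type*} [TopologicalSpace E] [Add E] [ContinuousAdd E] (s : E)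
    (y : E →ᵇ ℝ) (t : E) : shift s y t = y (t + s) := rfl

theorem derivResolvent_shift {l : ℝ} (hl : l ≠ 0) (s : ℝ) (y : ℝ →ᵇ ℝ) :
    derivResolvent l (shift s y) = shift s (derivResolvent l y) :=
  (eq_derivResolvent_of_hasDerivAt hl fun t =>
    (hasDerivAt_derivResolvent hl y (t + s)).comp_add_const t s).symm

theorem oscillatorResponse_shift {l₁ l₂ : ℝ} (hl₁ : l₁ ≠ 0) (hl₂ : l₂ ≠ 0) (s : ℝ)
    (y : ℝ →ᵇ ℝ) :
    oscillatorResponse l₁ l₂ (shift s y) = shift s (oscillatorResponse l₁ l₂ y) := by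
  simp only [oscillatorResponse, ContinuousLinearMap.comp_apply, derivResolvent_shift hl₁,
    derivResolvent_shift hl₂]

/-- `shift s y - y` is the derivative of the bounded function `t ↦ ∫ u in t..t + s, y u`. -/
theorem mean_shift (s : ℝ) (y : ℝ →ᵇ ℝ) : mean (shift s y) = mean y := by
  have hderiv (t : ℝ) : HasDerivAt (fun t => ∫ u in t..t + s, y u) ((shift s y - y) t) t := by
    have h (t : ℝ) : HasDerivAt (fun t => ∫ u in 0..t, y u) (y t) t :=
      (y.continuous.integral_hasStrictDerivAt 0 t).hasDerivAt
    refine (((h (t + s)).comp_add_const t s).sub (h t)).congr_of_eventuallyEq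
      (Eventually.of_forall fun t => ?_)
    exact (intervalIntegral.integral_interval_sub_left (y.continuous.intervalIntegrable _ _)
      (y.continuous.intervalIntegrable _ _)).symm
  have hbound (t : ℝ) : ‖∫ u in t..t + s, y u‖ ≤ ‖y‖ * |s| := by
    simpa using intervalIntegral.norm_integral_le_of_norm_le_const
      (fun u _ => y.norm_coe_le_norm u) (a := t) (b := t + s)
  have h := mean_deriv (y := .ofNormedAddCommGroup _
    (continuous_iff_continuousAt.2 fun t => (hderiv t).continuousAt) _ hbound) hderiv
  rwa [map_sub, sub_eq_zero] at h

theorem fluctuation_shift (s : ℝ) (y : ℝ →ᵇ ℝ) :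
    fluctuation (shift s y) = shift s (fluctuation y) := by
  ext t
  simp only [fluctuation_apply, shift_apply, mean_shift]

end Translation

section Mode

theorem abs_re_mul_cexp_le (a : ℝ) (c : ℂ) (t : ℝ) :
    |(c * Complex.exp (Complex.I * (a * t))).re| ≤ ‖c‖ := by
  refine (Complex.abs_re_le_norm _).trans_eq ?_
  rw [norm_mul, mul_comm Complex.I]
  norm_cast
  rw [Complex.norm_exp_ofReal_mul_I, mul_one]

/-- The real trigonometric monomial `t ↦ Re (c e^{i a t})`, as a function of the coefficient `c`. -/
def trigMode (a : ℝ) : ℂ →L[ℝ] (ℝ →ᵇ ℝ) :=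
  LinearMap.mkContinuous
    { toFun := fun c => .ofNormedAddCommGroup
        (fun t : ℝ => (c * Complex.exp (Complex.I * (a * t))).re) (by fun_prop) ‖c‖
        (abs_re_mul_cexp_le a c)
      map_add' := fun c c' => by ext t; simp [add_mul]
      map_smul' := fun r c => by ext t; simp [mul_assoc] }
    1 fun c => by
      rw [one_mul]
      exact BoundedContinuousFunction.norm_ofNormedAddCommGroup_le _ (norm_nonneg c)
        (abs_re_mul_cexp_le a c)

theorem trigMode_apply (a : ℝ) (c : ℂ) (t : ℝ) :
    trigMode a c t = (c * Complex.exp (Complex.I * (a * t))).re := rfl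

theorem norm_trigMode_le (a : ℝ) : ‖trigMode a‖ ≤ 1 :=
  LinearMap.mkContinuous_norm_le _ zero_le_one _

theorem trigMode_zero (c : ℂ) : trigMode 0 c = c.re • 1 := by
  ext t; simp [trigMode_apply]

theorem hasDerivAt_trigMode (a : ℝ) (c : ℂ) (t : ℝ) :
    HasDerivAt (trigMode a c) (trigMode a (c * (Complex.I * a)) t) t := by
  have h : HasDerivAt (fun s : ℂ => c * Complex.exp (Complex.I * (a * s)))
      (c * (Complex.exp (Complex.I * (a * t)) * (Complex.I * a))) t := by
    simpa using ((((hasDerivAt_id (t : ℂ)).const_mul (a : ℂ)).const_mul Complex.I).cexp).const_mul c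
  refine h.real_of_complex.congr_deriv ?_
  rw [trigMode_apply]
  congr 1
  ring

theorem hasDerivAt_trigMode_div {a : ℝ} (ha : a ≠ 0) (c : ℂ) (t : ℝ) :
    HasDerivAt (trigMode a (c / (Complex.I * a))) (trigMode a c t) t := by
  have h := hasDerivAt_trigMode a (c / (Complex.I * a)) t
  rwa [div_mul_cancel₀ _ (mul_ne_zero Complex.I_ne_zero (Complex.ofReal_ne_zero.2 ha))] at h

theorem mean_trigMode (a : ℝ) (c : ℂ) : mean (trigMode a c) = if a = 0 then c.re else 0 := by
  split_ifs with ha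
  · rw [ha, trigMode_zero, map_smul, mean_one, smul_eq_mul, mul_one]
  · exact mean_deriv (hasDerivAt_trigMode_div ha c)

end Mode

section CauchyBound

open scoped Nat

variable {E : Type*} [NormedAddCommGroup E] [NormedSpace ℝ E]

theorem nnnorm_changeOrigin_mul_pow_le {p : FormalMultilinearSeries ℝ E ℝ} {r : NNReal} {h : E}
    (hr : (r + r : ENNReal) < p.radius) (hh : ‖h‖₊ ≤ r) (k : ℕ) :
    ‖p.changeOrigin h k‖₊ * r ^ k ≤ ∑' s : Σ k l : ℕ, { s : Finset (Fin (k + l)) // s.card = l },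
      ‖p (s.1 + s.2.1)‖₊ * r ^ s.2.1 * r ^ s.1 := by
  have hsum := p.changeOriginSeries_summable_aux₁ hr
  have hr' : (r : ENNReal) < p.radius := le_self_add.trans_lt hr
  have hsum_k := p.changeOriginSeries_summable_aux₂ hr' k
  have hle : ‖p.changeOrigin h k‖₊ ≤
      ∑' s : Σ l : ℕ, { s : Finset (Fin (k + l)) // s.card = l }, ‖p (k + s.1)‖₊ * r ^ s.1 := by
    have hle_s (s : Σ l : ℕ, { s : Finset (Fin (k + l)) // s.card = l }) :
        ‖p (k + s.1)‖₊ * ‖h‖₊ ^ s.1 ≤ ‖p (k + s.1)‖₊ * r ^ s.1 := by gcongr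
    exact (p.nnnorm_changeOrigin_le k ((ENNReal.coe_le_coe.2 hh).trans_lt hr')).trans
      ((NNReal.summable_of_le hle_s hsum_k).tsum_le_tsum hle_s hsum_k)
  have hsigma := NNReal.summable_sigma.1 hsum
  calc _ ≤ _ := mul_le_mul_left hle (r ^ k)
    _ = ∑' s : Σ l : ℕ, { s : Finset (Fin (k + l)) // s.card = l },
          ‖p (k + s.1)‖₊ * r ^ s.1 * r ^ k := (NNReal.tsum_mul_right _ _).symm
    _ ≤ _ := hsigma.2.le_tsum k fun _ _ => zero_le
    _ = _ := (hsum.tsum_sigma' hsigma.1).symm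

theorem norm_iteratedFDeriv_le_factorial_mul {f : E → ℝ} {p : FormalMultilinearSeries ℝ E ℝ} {x : E}
    {r : ENNReal} (hp : HasFPowerSeriesOnBall f p x r) (n : ℕ) :
    ‖iteratedFDeriv ℝ n f x‖ ≤ n ! * ‖p n‖ := by
  refine ContinuousMultilinearMap.opNorm_le_bound (by positivity) fun v => ?_
  rw [hp.iteratedFDeriv_eq_sum_of_completeSpace v]
  calc _ ≤ ∑ _ : Equiv.Perm (Fin n), ‖p n‖ * ∏ i, ‖v i‖ := norm_sum_le_of_le _ fun σ _ =>
        ((p n).le_opNorm _).trans_eq (by rw [Equiv.prod_comp σ fun i => ‖v i‖])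
    _ = n ! * ‖p n‖ * ∏ i, ‖v i‖ := by
        rw [Finset.sum_const, Finset.card_univ, Fintype.card_perm, Fintype.card_fin, nsmul_eq_mul,
          mul_assoc]

/-- Cauchy estimates with constant `M` for the Taylor series of `f` at `x`, together with its
convergence to `f` on the ball of radius `M⁻¹` about `x`. -/
def HasCauchyBound (f : E → ℝ) (M : NNReal) (x : E) : Prop :=
  (∀ n, ‖iteratedFDeriv ℝ n f x‖ ≤ n ! * M ^ (n + 1)) ∧
    ∀ v, M * ‖v‖ < 1 →
      HasSum (fun n => (n ! : ℝ)⁻¹ • iteratedFDeriv ℝ n f x fun _ => v) (f (x + v))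

variable {f : E → ℝ} {M M' : NNReal} {x : E}

theorem HasCauchyBound.mono (h : HasCauchyBound f M x) (hM : M ≤ M') :
    HasCauchyBound f M' x :=
  ⟨fun n => (h.1 n).trans (by gcongr), fun v hv => h.2 v (lt_of_le_of_lt (by gcongr) hv)⟩

theorem exists_eventually_hasCauchyBound (hf : AnalyticAt ℝ f x) :
    ∃ M : NNReal, ∀ᶠ y in 𝓝 x, HasCauchyBound f M y := by
  obtain ⟨p, R, hp⟩ := hf
  obtain ⟨ρ, hρ0, hρ⟩ := ENNReal.lt_iff_exists_nnreal_btwn.1 hp.r_pos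
  obtain ⟨r, rfl⟩ : ∃ r : NNReal, ρ = r + r := ⟨ρ / 2, (add_halves ρ).symm⟩
  rw [ENNReal.coe_add] at hρ
  have hr0 : 0 < r := by simpa using hρ0
  let C : NNReal := ∑' s : Σ k l : ℕ, { s : Finset (Fin (k + l)) // s.card = l },
    ‖p (s.1 + s.2.1)‖₊ * r ^ s.2.1 * r ^ s.1
  let M := max C r⁻¹
  have hCM : (C : ℝ) ≤ M := NNReal.coe_le_coe.2 (le_max_left _ _)
  have hrM : ((r⁻¹ : NNReal) : ℝ) ≤ M := NNReal.coe_le_coe.2 (le_max_right _ _)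
  rw [NNReal.coe_inv] at hrM
  refine ⟨M, mem_of_superset (Metric.ball_mem_nhds x (NNReal.coe_pos.2 hr0)) fun y hy => ?_⟩
  obtain ⟨h, rfl⟩ : ∃ h, y = x + h := ⟨y - x, (add_sub_cancel x y).symm⟩
  have hh : ‖h‖₊ < r := NNReal.coe_lt_coe.1 (by simpa [mem_ball_iff_norm] using hy)
  have hhR : (‖h‖₊ : ENNReal) < R :=
    (ENNReal.coe_le_coe.2 hh.le).trans_lt (le_self_add.trans_lt hρ)
  have hq := hp.changeOrigin hhR
  refine ⟨fun n => (norm_iteratedFDeriv_le_factorial_mul hq n).trans ?_,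
    fun v hv => hq.hasSum_iteratedFDeriv ?_⟩
  · have hle : ‖p.changeOrigin h n‖ * (r : ℝ) ^ n ≤ C := by
      exact_mod_cast nnnorm_changeOrigin_mul_pow_le (hρ.trans_le hp.r_le) hh.le n
    have : (0 : ℝ) < r := hr0
    gcongr
    calc ‖p.changeOrigin h n‖ ≤ C * (r : ℝ)⁻¹ ^ n := by
          rwa [inv_pow, ← div_eq_mul_inv, le_div_iff₀ (by positivity)]
      _ ≤ M * M ^ n := by gcongr
      _ = _ := (pow_succ' _ _).symm
  · have hv' : (r : ℝ)⁻¹ * ‖v‖ < 1 := lt_of_le_of_lt (by gcongr) hv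
    replace hv' : ‖v‖₊ < r := (inv_mul_lt_one₀ (NNReal.coe_pos.2 hr0)).1 hv'
    rw [mem_eball_zero_iff, lt_tsub_iff_right]
    exact (ENNReal.add_lt_add (ENNReal.coe_lt_coe.2 hv') (ENNReal.coe_lt_coe.2 hh)).trans hρ

theorem exists_forall_hasCauchyBound {K : Set E} (hK : IsCompact K) (hf : AnalyticOnNhd ℝ f K) :
    ∃ M : NNReal, 0 < M ∧ ∀ x ∈ K, HasCauchyBound f M x := by
  suffices ∃ M : NNReal, ∀ x ∈ K, HasCauchyBound f M x by
    obtain ⟨M, hM⟩ := this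
    exact ⟨M + 1, by positivity, fun x hx => (hM x hx).mono le_self_add⟩
  refine hK.induction_on (p := fun K => ∃ M : NNReal, ∀ x ∈ K, HasCauchyBound f M x) ⟨1, by simp⟩
    (fun s t hst ⟨M, hM⟩ => ⟨M, fun x hx => hM x (hst hx)⟩) ?_ fun x hx => ?_
  · rintro s t ⟨M, hM⟩ ⟨M', hM'⟩
    exact ⟨max M M', fun x hx => hx.elim
      (fun hx => (hM x hx).mono (le_max_left _ _))
      (fun hx => (hM' x hx).mono (le_max_right _ _))⟩
  · obtain ⟨M, hM⟩ := exists_eventually_hasCauchyBound (hf x hx)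
    exact ⟨_, mem_nhdsWithin_of_mem_nhds hM, M, fun y hy => hy⟩

end CauchyBound

section ShiftOrbit

open scoped Nat

variable {E : Type*} [NormedAddCommGroup E] [NormedSpace ℝ E] {f : E →ᵇ ℝ} {M : NNReal}

theorem HasCauchyBound.norm_taylorCoeff_le {f : E → ℝ} {x : E} (h : HasCauchyBound f M x) {n : ℕ}
    (v : Fin n → E) :
    ‖(n ! : ℝ)⁻¹ * iteratedFDeriv ℝ n f x v‖ ≤ M ^ (n + 1) * ∏ i, ‖v i‖ := by
  rw [norm_mul, norm_inv, Real.norm_natCast, inv_mul_le_iff₀ (by positivity), ← mul_assoc]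
  exact (iteratedFDeriv ℝ n f x).le_of_opNorm_le (h.1 n) v

/-- The Taylor series at `0` of the orbit `s ↦ shift s f` under translations. -/
def shiftTaylorSeries (hf : ContDiff ℝ ⊤ f) (hM : ∀ x, HasCauchyBound f M x) :
    FormalMultilinearSeries ℝ E (E →ᵇ ℝ) := fun n =>
  MultilinearMap.mkContinuous
    { toFun := fun v => .ofNormedAddCommGroup
        (fun x => (n ! : ℝ)⁻¹ * iteratedFDeriv ℝ n f x v)
        (((hf.continuous_iteratedFDeriv (m := n) le_top).eval_const v).const_mul _) _
        fun x => (hM x).norm_taylorCoeff_le v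
      map_update_add' := fun v i a b => by ext x; simp [mul_add]
      map_update_smul' := fun v i c a => by ext x; simp [mul_left_comm] }
    (M ^ (n + 1))
    fun v => (BoundedContinuousFunction.norm_le
        ((norm_nonneg _).trans ((hM 0).norm_taylorCoeff_le v))).2
      fun x => (hM x).norm_taylorCoeff_le v

theorem norm_shiftTaylorSeries_le (hf : ContDiff ℝ ⊤ f) (hM : ∀ x, HasCauchyBound f M x) (n : ℕ) :
    ‖shiftTaylorSeries hf hM n‖ ≤ M ^ (n + 1) :=
  MultilinearMap.mkContinuous_norm_le _ (by positivity) _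

theorem hasFPowerSeriesOnBall_shift (hf : ContDiff ℝ ⊤ f) (hM : ∀ x, HasCauchyBound f M x)
    (hM0 : 0 < M) :
    HasFPowerSeriesOnBall (fun s => shift s f) (shiftTaylorSeries hf hM) 0 (M⁻¹ : NNReal) := by
  have hradius : ((M⁻¹ : NNReal) : ENNReal) ≤ (shiftTaylorSeries hf hM).radius :=
    FormalMultilinearSeries.le_radius_of_bound _ M fun n => by
      rw [NNReal.coe_inv, inv_pow, mul_inv_le_iff₀ (by positivity), ← pow_succ']
      exact norm_shiftTaylorSeries_le hf hM n
  refine ⟨hradius, by simpa using hM0, fun {v} hv => ?_⟩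
  have hsum := (shiftTaylorSeries hf hM).hasSum (Metric.eball_subset_eball hradius hv)
  convert! hsum using 1
  ext x
  have hv' : (M : ℝ) * ‖v‖ < 1 := by
    have h : ‖v‖₊ < M⁻¹ := ENNReal.coe_lt_coe.1 (mem_eball_zero_iff.1 hv)
    exact (lt_inv_mul_iff₀ (NNReal.coe_pos.2 hM0)).1 (by simpa using NNReal.coe_lt_coe.2 h)
  rw [zero_add, shift_apply]
  exact ((hM x).2 v hv').unique (hsum.mapL (BoundedContinuousFunction.evalCLM ℝ x))

theorem analyticAt_shift (hf : ContDiff ℝ ⊤ f) (hM : ∀ x, HasCauchyBound f M x) (hM0 : 0 < M)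
    (s : E) : AnalyticAt ℝ (fun s => shift s f) s := by
  have h0 : AnalyticAt ℝ (fun s => shift s f) (s - s) := by
    rw [sub_self]
    exact (hasFPowerSeriesOnBall_shift hf hM hM0).analyticAt
  have h := ((shift s).analyticAt _).comp
    (h0.comp (f := fun u => u - s) (analyticAt_id.sub analyticAt_const))
  refine h.congr (Eventually.of_forall fun u => ?_)
  ext x
  simp [shift_apply, add_assoc]

end ShiftOrbit

section Lattice

variable {d : ℕ}

theorem freqDot_add_left (x y : Fin d → ℝ) (ν : Fin d → ℤ) :
    freqDot (x + y) ν = freqDot x ν + freqDot y ν := by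
  simp [freqDot, add_mul, Finset.sum_add_distrib]

theorem freqDot_smul_left (t : ℝ) (x : Fin d → ℝ) (ν : Fin d → ℤ) :
    freqDot (t • x) ν = t * freqDot x ν := by
  simp [freqDot, Finset.mul_sum, mul_assoc]

theorem freqDot_neg_right (x : Fin d → ℝ) (ν : Fin d → ℤ) : freqDot x (-ν) = -freqDot x ν := by
  simp [freqDot]

/-- The `ℓ¹` norm of an integer vector. -/
def absSum (ν : Fin d → ℤ) : ℝ := ∑ i, |(ν i : ℝ)|

theorem exists_freqDot_eq_absSum (ν : Fin d → ℤ) :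
    ∃ h : Fin d → ℝ, ‖h‖ ≤ 1 ∧ freqDot h ν = absSum ν := by
  refine ⟨fun i => SignType.sign (ν i : ℝ),
    (pi_norm_le_iff_of_nonneg zero_le_one).2 fun i => ?_, ?_⟩
  · rcases lt_trichotomy (ν i : ℝ) 0 with h | h | h <;> simp [h]
  · exact Finset.sum_congr rfl fun i _ => sign_mul_self _

theorem summable_exp_neg_mul_abs_intCast {δ : ℝ} (hδ : 0 < δ) :
    Summable fun n : ℤ => Real.exp (-(δ * |(n : ℝ)|)) := by
  have h : Summable fun n : ℕ => Real.exp (-(δ * (n : ℝ))) :=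
    (Real.summable_exp_nat_mul_iff.2 (neg_lt_zero.2 hδ)).congr fun n => by congr 1; ring
  refine Summable.of_nat_of_neg ?_ ?_ <;> simpa using h

theorem summable_exp_neg_mul_absSum (d : ℕ) {δ : ℝ} (hδ : 0 < δ) :
    Summable fun ν : Fin d → ℤ => Real.exp (-(δ * absSum ν)) := by
  induction d with
  | zero => exact Summable.of_finite
  | succ d ih =>
    rw [← (Fin.consEquiv fun _ => ℤ).summable_iff]
    refine ((summable_exp_neg_mul_abs_intCast hδ).mul_of_nonneg ih (fun _ => Real.exp_nonneg _)
      fun _ => Real.exp_nonneg _).congr fun p => ?_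
    rw [← Real.exp_add]
    simp [absSum, Fin.sum_univ_succ, Fin.consEquiv]
    ring

end Lattice

section Periodic

variable {d : ℕ} {F : (Fin d → ℝ) → ℝ}

theorem exists_add_two_pi_mul_mem_Icc (x : Fin d → ℝ) :
    ∃ ν : Fin d → ℤ, (x + fun i => 2 * Real.pi * (ν i : ℝ)) ∈ Icc 0 fun _ => 2 * Real.pi := by
  have h (i : Fin d) : ∃ n : ℤ, x i + 2 * Real.pi * n ∈ Ico 0 (2 * Real.pi) := by
    obtain ⟨n, hn, -⟩ := existsUnique_add_zsmul_mem_Ico Real.two_pi_pos (x i) 0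
    exact ⟨n, by simpa [mul_comm] using hn⟩
  choose ν hν using h
  exact ⟨ν, fun i => (hν i).1, fun i => (hν i).2.le⟩

theorem TorusPeriodic.comp_add (hF : TorusPeriodic F) (v : Fin d → ℝ) :
    TorusPeriodic fun ψ => F (ψ + v) := fun ψ ν =>
  (congrArg F (add_right_comm ψ _ v)).trans (hF (ψ + v) ν)

theorem TorusPeriodic.exists_boundedContinuousFunction (hF : TorusPeriodic F)
    (hc : Continuous F) : ∃ G : (Fin d → ℝ) →ᵇ ℝ, ⇑G = F := by
  obtain ⟨B, hB⟩ := isCompact_Icc.exists_bound_of_continuousOn hc.continuousOn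
  refine ⟨.ofNormedAddCommGroup F hc B fun x => ?_, rfl⟩
  obtain ⟨ν, hν⟩ := exists_add_two_pi_mul_mem_Icc x
  rw [← hF x ν]
  exact hB _ hν

theorem TorusPeriodic.hasCauchyBound_iff (hF : TorusPeriodic F) {M : NNReal} (x : Fin d → ℝ)
    (ν : Fin d → ℤ) :
    HasCauchyBound F M (x + fun i => 2 * Real.pi * (ν i : ℝ)) ↔ HasCauchyBound F M x := by
  have hperiod : (fun ψ => F (ψ + fun i => 2 * Real.pi * (ν i : ℝ))) = F := funext fun ψ => hF ψ ν
  have hderiv (n : ℕ) : iteratedFDeriv ℝ n F (x + fun i => 2 * Real.pi * (ν i : ℝ)) =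
      iteratedFDeriv ℝ n F x := by
    rw [← iteratedFDeriv_comp_add_right, hperiod]
  have hvalue (v : Fin d → ℝ) : F (x + (fun i => 2 * Real.pi * (ν i : ℝ)) + v) = F (x + v) := by
    rw [add_right_comm]; exact hF (x + v) ν
  simp only [HasCauchyBound, hderiv, hvalue]

theorem TorusAnalytic.exists_forall_hasCauchyBound (hF : TorusAnalytic F) :
    ∃ M : NNReal, 0 < M ∧ ∀ x, HasCauchyBound F M x := by
  obtain ⟨M, hM0, hM⟩ := _root_.exists_forall_hasCauchyBound
    (isCompact_Icc (a := (0 : Fin d → ℝ)) (b := fun _ => 2 * Real.pi)) (hF.1.mono (subset_univ _))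
  refine ⟨M, hM0, fun x => ?_⟩
  obtain ⟨ν, hν⟩ := exists_add_two_pi_mul_mem_Icc x
  exact (hF.2.hasCauchyBound_iff x ν).1 (hM _ hν)

end Periodic

section Fourier

variable {d : ℕ}

/-- The function on the standard torus induced by a function of period `2π`. -/
def torusLift (F : (Fin d → ℝ) → ℝ) (y : UnitAddTorus (Fin d)) : ℂ :=
  (F (fun i => 2 * Real.pi * (AddCircle.equivIco 1 0 (y i) : ℝ)) : ℂ)

theorem torusLift_coe {F : (Fin d → ℝ) → ℝ} (hF : TorusPeriodic F) (x : Fin d → ℝ) :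
    torusLift F (fun i => (x i : UnitAddCircle)) = F ((2 * Real.pi) • x) := by
  unfold torusLift
  rw [← hF ((2 * Real.pi) • x) fun i => -⌊x i⌋]
  congr 2
  ext i
  rw [AddCircle.coe_equivIco_mk_apply, div_one, mul_one, ← Int.self_sub_floor]
  simp only [Pi.smul_apply, smul_eq_mul, Int.cast_neg]
  ring

theorem continuous_torusLift {F : (Fin d → ℝ) → ℝ} (hF : TorusPeriodic F) (hc : Continuous F) :
    Continuous (torusLift F) := by
  have hq : IsOpenQuotientMap (Pi.map fun (_ : Fin d) (x : ℝ) => (x : UnitAddCircle)) :=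
    IsOpenQuotientMap.piMap fun _ => QuotientAddGroup.isOpenQuotientMap_mk
  rw [hq.isQuotientMap.continuous_iff]
  have : torusLift F ∘ (Pi.map fun (_ : Fin d) (x : ℝ) => (x : UnitAddCircle)) =
      fun x => ((F ((2 * Real.pi) • x) : ℝ) : ℂ) := by
    ext x
    exact torusLift_coe hF x
  rw [this]
  fun_prop

theorem mFourier_coe (ν : Fin d → ℤ) (x : Fin d → ℝ) :
    UnitAddTorus.mFourier ν (fun i => (x i : UnitAddCircle)) =
      Complex.exp (Complex.I * (freqDot ((2 * Real.pi) • x) ν : ℂ)) := by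
  simp only [UnitAddTorus.mFourier, ContinuousMap.coe_mk, fourier_coe_apply]
  rw [← Complex.exp_sum]
  congr 1
  simp only [freqDot, Pi.smul_apply, smul_eq_mul]
  push_cast
  rw [Finset.mul_sum]
  exact Finset.sum_congr rfl fun i _ => by ring

open scoped Pointwise in
theorem smul_set_pi_Ioc {c : ℝ} (hc : 0 < c) (a : Fin d → ℝ) :
    c • {x : Fin d → ℝ | ∀ i, x i ∈ Ioc (c⁻¹ * a i) (c⁻¹ * a i + 1)} =
      univ.pi fun i => Ioc (a i) (a i + c) := by
  ext ψ
  rw [mem_smul_set_iff_inv_smul_mem₀ hc.ne']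
  simp only [mem_ofPred_eq, mem_univ_pi, Pi.smul_apply, smul_eq_mul, mem_Ioc]
  refine forall_congr' fun i => and_congr (mul_lt_mul_iff_right₀ (inv_pos.2 hc)) ?_
  have : c⁻¹ * a i + 1 = c⁻¹ * (a i + c) := by field_simp
  rw [this, mul_le_mul_iff_right₀ (inv_pos.2 hc)]

theorem mFourierCoeff_torusLift {F : (Fin d → ℝ) → ℝ} (hF : TorusPeriodic F) (ν : Fin d → ℤ)
    (a : Fin d → ℝ) :
    UnitAddTorus.mFourierCoeff (torusLift F) ν = ((2 * Real.pi) ^ d : ℂ)⁻¹ *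
      ∫ ψ in univ.pi fun i => Ioc (a i) (a i + 2 * Real.pi),
        (F ψ : ℂ) * Complex.exp (-Complex.I * (freqDot ψ ν : ℂ)) := by
  rw [UnitAddTorus.mFourierCoeff_eq_integral _ _ fun i => (2 * Real.pi)⁻¹ * a i,
    ← smul_set_pi_Ioc Real.two_pi_pos]
  have h := Measure.setIntegral_comp_smul_of_pos (volume : Measure (Fin d → ℝ))
    (fun ψ => (F ψ : ℂ) * Complex.exp (-Complex.I * (freqDot ψ ν : ℂ)))
    {x : Fin d → ℝ | ∀ i, x i ∈ Ioc ((2 * Real.pi)⁻¹ * a i) ((2 * Real.pi)⁻¹ * a i + 1)}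
    Real.two_pi_pos
  rw [Module.finrank_fintype_fun_eq_card, Fintype.card_fin] at h
  have e : ((2 * Real.pi) ^ d : ℂ)⁻¹ = (((2 * Real.pi) ^ d)⁻¹ : ℝ) := by push_cast; rfl
  rw [e, ← Complex.real_smul, ← h]
  congr 1
  ext x
  rw [torusLift_coe hF, mFourier_coe, smul_eq_mul, mul_comm, freqDot_neg_right]
  push_cast
  rw [mul_neg, neg_mul]

theorem torusFourierCoeff_eq_mFourierCoeff {F : (Fin d → ℝ) → ℝ} (hF : TorusPeriodic F)
    (ν : Fin d → ℤ) : torusFourierCoeff F ν = UnitAddTorus.mFourierCoeff (torusLift F) ν := by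
  rw [mFourierCoeff_torusLift hF ν 0, torusFourierCoeff]
  congr 1
  refine (setIntegral_congr_set ?_).symm
  simpa using! Measure.univ_pi_Ioc_ae_eq_Icc (μ := fun _ : Fin d => (volume : Measure ℝ))
    (f := 0) (g := fun _ => 2 * Real.pi)

theorem torusFourierCoeff_comp_add {F : (Fin d → ℝ) → ℝ} (hF : TorusPeriodic F)
    (v : Fin d → ℝ) (ν : Fin d → ℤ) :
    torusFourierCoeff (fun ψ => F (ψ + v)) ν =
      Complex.exp (Complex.I * (freqDot v ν : ℂ)) * torusFourierCoeff F ν := by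
  have hF' := hF.comp_add v
  rw [torusFourierCoeff_eq_mFourierCoeff hF, torusFourierCoeff_eq_mFourierCoeff hF',
    mFourierCoeff_torusLift hF ν v, mFourierCoeff_torusLift hF' ν 0, mul_left_comm,
    ← integral_const_mul (Complex.exp (Complex.I * (freqDot v ν : ℂ))),
    ← (measurePreserving_add_right volume v).setIntegral_preimage_emb
      (measurableEmbedding_addRight v) _ (univ.pi fun i => Ioc (v i) (v i + 2 * Real.pi))]
  have hset : (univ.pi fun i => Ioc ((0 : Fin d → ℝ) i) ((0 : Fin d → ℝ) i + 2 * Real.pi)) =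
      (fun ψ : Fin d → ℝ => ψ + v) ⁻¹' univ.pi fun i => Ioc (v i) (v i + 2 * Real.pi) := by
    ext ψ
    simp only [mem_univ_pi, mem_preimage, mem_Ioc, Pi.add_apply, Pi.zero_apply, zero_add]
    refine forall_congr' fun i => ?_
    constructor <;> rintro ⟨h1, h2⟩ <;> constructor <;> linarith
  rw [hset]
  congr 1
  refine integral_congr_ae (Eventually.of_forall fun ψ => ?_)
  dsimp only
  rw [mul_left_comm, ← Complex.exp_add, freqDot_add_left]
  congr 2
  push_cast
  ring

theorem norm_torusFourierCoeff_le {F : (Fin d → ℝ) → ℝ} {B : ℝ}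
    (hB : ∀ ψ ∈ Icc (0 : Fin d → ℝ) (fun _ => 2 * Real.pi), |F ψ| ≤ B) (ν : Fin d → ℤ) :
    ‖torusFourierCoeff F ν‖ ≤ B := by
  have hvol : volume.real (Icc (0 : Fin d → ℝ) (fun _ => 2 * Real.pi)) = (2 * Real.pi) ^ d := by
    rw [Measure.real,
      Real.volume_Icc_pi_toReal (a := (0 : Fin d → ℝ)) (fun _ => Real.two_pi_pos.le)]
    simp
  have h := norm_setIntegral_le_of_norm_le_const
    (μ := volume) (s := Icc (0 : Fin d → ℝ) (fun _ => 2 * Real.pi))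
    (f := fun ψ => (F ψ : ℂ) * Complex.exp (-Complex.I * (freqDot ψ ν : ℂ))) (C := B)
    isCompact_Icc.measure_lt_top (fun ψ hψ => by
      have e : -Complex.I * (freqDot ψ ν : ℂ) = ((-freqDot ψ ν : ℝ) : ℂ) * Complex.I := by
        push_cast; ring
      rw [norm_mul, e, Complex.norm_exp_ofReal_mul_I, mul_one, Complex.norm_real]
      exact hB ψ hψ)
  rw [hvol] at h
  have hp : (0 : ℝ) < (2 * Real.pi) ^ d := by positivity
  rw [torusFourierCoeff, norm_mul, norm_inv]
  have e : ‖((2 * Real.pi) ^ d : ℂ)‖ = (2 * Real.pi) ^ d := by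
    rw [norm_pow, norm_mul, Complex.norm_real, Complex.norm_ofNat, Real.norm_eq_abs,
      abs_of_pos Real.pi_pos]
  rw [e, inv_mul_le_iff₀ hp, mul_comm _ B]
  exact h

open scoped Nat

theorem hasSum_torusFourierCoeff {F : (Fin d → ℝ) → ℝ} (hF : TorusPeriodic F) (hc : Continuous F)
    (hs : Summable fun ν => torusFourierCoeff F ν) (ψ : Fin d → ℝ) :
    HasSum (fun ν => torusFourierCoeff F ν * Complex.exp (Complex.I * (freqDot ψ ν : ℂ)))
      (F ψ) := by
  have hs' : Summable (UnitAddTorus.mFourierCoeff (⟨torusLift F, continuous_torusLift hF hc⟩ :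
      C(UnitAddTorus (Fin d), ℂ))) :=
    hs.congr fun ν => torusFourierCoeff_eq_mFourierCoeff hF ν
  have h := UnitAddTorus.hasSum_mFourier_series_apply_of_summable hs'
    (fun i => (((2 * Real.pi)⁻¹ • ψ) i : UnitAddCircle))
  simp only [mFourier_coe, ContinuousMap.coe_mk, torusLift_coe hF,
    smul_inv_smul₀ Real.two_pi_pos.ne' ψ] at h
  exact h.congr_fun fun ν => by rw [torusFourierCoeff_eq_mFourierCoeff hF, smul_eq_mul]

/-- The Fourier coefficient of index `ν`, as a continuous linear functional on bounded continuous
functions. -/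
def torusFourierCoeffCLM (ν : Fin d → ℤ) : ((Fin d → ℝ) →ᵇ ℝ) →L[ℝ] ℂ :=
  LinearMap.mkContinuous
    { toFun := fun F => torusFourierCoeff F ν
      map_add' := fun F G => by
        have hint (F : (Fin d → ℝ) →ᵇ ℝ) : IntegrableOn
            (fun ψ => (F ψ : ℂ) * Complex.exp (-Complex.I * (freqDot ψ ν : ℂ)))
            (Icc 0 fun _ => 2 * Real.pi) :=
          Continuous.integrableOn_Icc (by unfold freqDot; fun_prop)
        simp only [torusFourierCoeff, BoundedContinuousFunction.coe_add, Pi.add_apply,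
          Complex.ofReal_add, add_mul]
        rw [integral_add (hint F) (hint G), mul_add]
      map_smul' := fun c F => by
        simp only [torusFourierCoeff, BoundedContinuousFunction.coe_smul, smul_eq_mul,
          Complex.ofReal_mul, mul_assoc, RingHom.id_apply, Complex.real_smul]
        rw [integral_const_mul, mul_left_comm] }
    1 fun F => by
      rw [one_mul]
      exact norm_torusFourierCoeff_le (fun ψ _ => F.norm_coe_le_norm ψ) ν

theorem torusFourierCoeffCLM_apply (ν : Fin d → ℤ) (F : (Fin d → ℝ) →ᵇ ℝ) :
    torusFourierCoeffCLM ν F = torusFourierCoeff F ν := rfl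

theorem norm_torusFourierCoeffCLM_le (ν : Fin d → ℤ) : ‖torusFourierCoeffCLM ν‖ ≤ 1 :=
  LinearMap.mkContinuous_norm_le _ zero_le_one _

theorem hasFPowerSeriesAt_cexp_smul_mul (z c : ℂ) :
    HasFPowerSeriesAt (fun s : ℝ => Complex.exp (s • z) * c)
      (((ContinuousLinearMap.mul ℝ ℂ).flip c).compFormalMultilinearSeries
        ((NormedSpace.expSeries ℝ ℂ).compContinuousLinearMap
          (ContinuousLinearMap.toSpanSingleton ℝ z))) 0 := by
  have h := ((ContinuousLinearMap.mul ℝ ℂ).flip c).comp_hasFPowerSeriesOnBall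
    ((map_zero (ContinuousLinearMap.toSpanSingleton ℝ z)).symm ▸
      NormedSpace.exp_hasFPowerSeriesOnBall (𝕂 := ℝ) (𝔸 := ℂ)).compContinuousLinearMap
  rw [← Complex.exp_eq_exp_ℂ] at h
  exact h.hasFPowerSeriesAt

variable {F : (Fin d → ℝ) →ᵇ ℝ} {M : NNReal}

/-- Both sides are the `n`-th Taylor coefficient at `s = 0` of
`s ↦ torusFourierCoeff (shift (s • h) F) ν`. -/
theorem torusFourierCoeffCLM_shiftTaylorSeries (hF : TorusPeriodic F) (hc : ContDiff ℝ ⊤ F)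
    (hM : ∀ x, HasCauchyBound F M x) (hM0 : 0 < M) (ν : Fin d → ℤ) (h : Fin d → ℝ) (n : ℕ) :
    torusFourierCoeffCLM ν (shiftTaylorSeries hc hM n fun _ => h) =
      (n ! : ℝ)⁻¹ • (Complex.I * freqDot h ν) ^ n * torusFourierCoeff F ν := by
  have hshift : HasFPowerSeriesAt
      (fun s : ℝ => torusFourierCoeffCLM ν (shift (s • h) F)) _ 0 :=
    ((torusFourierCoeffCLM ν).comp_hasFPowerSeriesOnBall
      ((map_zero (ContinuousLinearMap.toSpanSingleton ℝ h)).symm ▸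
        hasFPowerSeriesOnBall_shift hc hM hM0).compContinuousLinearMap).hasFPowerSeriesAt
  have hexp := hasFPowerSeriesAt_cexp_smul_mul (Complex.I * freqDot h ν) (torusFourierCoeff F ν)
  have heq (s : ℝ) : torusFourierCoeffCLM ν (shift (s • h) F) =
      Complex.exp (s • (Complex.I * freqDot h ν)) * torusFourierCoeff F ν := by
    have h := torusFourierCoeff_comp_add hF (s • h) ν
    rw [freqDot_smul_left, Complex.ofReal_mul, mul_left_comm, ← Complex.real_smul] at h
    exact (torusFourierCoeffCLM_apply ν _).trans h
  have hcoeff := congrArg (fun p : FormalMultilinearSeries ℝ ℝ ℂ => p n fun _ => 1)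
    (hshift.eq_formalMultilinearSeries
      (hexp.congr (Eventually.of_forall fun s => (heq s).symm)))
  simpa only [ContinuousLinearMap.compFormalMultilinearSeries_apply',
    FormalMultilinearSeries.compContinuousLinearMap_apply, NormedSpace.expSeries_apply_eq,
    Function.comp_def, ContinuousLinearMap.toSpanSingleton_apply, one_smul,
    ContinuousLinearMap.flip_apply, ContinuousLinearMap.mul_apply'] using hcoeff

theorem norm_torusFourierCoeff_le_exp (hF : TorusPeriodic F) (hc : ContDiff ℝ ⊤ F)
    (hM : ∀ x, HasCauchyBound F M x) (hM0 : 0 < M) (ν : Fin d → ℤ) :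
    ‖torusFourierCoeff F ν‖ ≤ 2 * M * Real.exp (-((2 * M : ℝ)⁻¹ * absSum ν)) := by
  obtain ⟨h, hh, hν⟩ := exists_freqDot_eq_absSum ν
  have hM0' : (0 : ℝ) < M := hM0
  have habs : 0 ≤ absSum ν := Finset.sum_nonneg fun _ _ => abs_nonneg _
  have hcoeff (n : ℕ) : (n ! : ℝ)⁻¹ * absSum ν ^ n * ‖torusFourierCoeff F ν‖ ≤ M ^ (n + 1) := by
    have hle := ((torusFourierCoeffCLM ν).le_of_opNorm_le (norm_torusFourierCoeffCLM_le ν) _).trans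
      ((one_mul _).trans_le ((shiftTaylorSeries hc hM n).le_of_opNorm_le
        (norm_shiftTaylorSeries_le hc hM n) fun _ => h))
    rw [torusFourierCoeffCLM_shiftTaylorSeries hF hc hM hM0, hν, norm_mul, norm_smul, norm_pow,
      norm_mul, Complex.norm_I, one_mul, Complex.norm_real, Real.norm_of_nonneg habs, norm_inv,
      Real.norm_natCast, Finset.prod_const, Finset.card_univ, Fintype.card_fin] at hle
    exact hle.trans (mul_le_of_le_one_right (by positivity) (pow_le_one₀ (norm_nonneg h) hh))
  have hterm (n : ℕ) : ((2 * M : ℝ)⁻¹ * absSum ν) ^ n / n ! * ‖torusFourierCoeff F ν‖ ≤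
      M * (1 / 2) ^ n := by
    calc _ = ((2 * M : ℝ)⁻¹) ^ n * ((n ! : ℝ)⁻¹ * absSum ν ^ n * ‖torusFourierCoeff F ν‖) := by
          rw [mul_pow]; ring
      _ ≤ ((2 * M : ℝ)⁻¹) ^ n * M ^ (n + 1) := by gcongr; exact hcoeff n
      _ = M * ((2 * M : ℝ)⁻¹ * M) ^ n := by rw [mul_pow]; ring
      _ = _ := by rw [mul_inv, inv_mul_cancel_right₀ hM0'.ne', one_div]
  have hexp := (NormedSpace.expSeries_div_hasSum_exp ((2 * M : ℝ)⁻¹ * absSum ν)).mul_right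
    ‖torusFourierCoeff F ν‖
  rw [← Real.exp_eq_exp_ℝ] at hexp
  have hle := hasSum_le hterm hexp (hasSum_geometric_two.mul_left (M : ℝ))
  rw [Real.exp_neg, ← div_eq_mul_inv, le_div_iff₀ (Real.exp_pos _)]
  linarith

theorem TorusAnalytic.summable_norm_torusFourierCoeff (hF : TorusAnalytic F) :
    Summable fun ν => ‖torusFourierCoeff F ν‖ := by
  obtain ⟨M, hM0, hM⟩ := hF.exists_forall_hasCauchyBound
  refine Summable.of_nonneg_of_le (fun _ => norm_nonneg _)
    (norm_torusFourierCoeff_le_exp hF.2 hF.1.contDiff hM hM0)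
    ((summable_exp_neg_mul_absSum d ?_).mul_left _)
  have : (0 : ℝ) < M := hM0
  positivity

/-- The quasi-periodic function `t ↦ F (t ω + ψ)`. -/
def quasiPeriodic (ω : Fin d → ℝ) (F : (Fin d → ℝ) →ᵇ ℝ) (ψ : Fin d → ℝ) : ℝ →ᵇ ℝ :=
  pullback ⟨fun t : ℝ => t • ω, by fun_prop⟩ (shift ψ F)

theorem quasiPeriodic_apply (ω : Fin d → ℝ) (F : (Fin d → ℝ) →ᵇ ℝ) (ψ : Fin d → ℝ) (t : ℝ) :
    quasiPeriodic ω F ψ t = F (t • ω + ψ) := rfl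

theorem quasiPeriodic_smul (ω : Fin d → ℝ) (F : (Fin d → ℝ) →ᵇ ℝ) (s : ℝ) :
    quasiPeriodic ω F (s • ω) = shift s (quasiPeriodic ω F 0) := by
  ext t
  simp only [quasiPeriodic_apply, shift_apply, add_smul, add_zero]

theorem TorusPeriodic.quasiPeriodic_add (hF : TorusPeriodic F) (ω ψ : Fin d → ℝ)
    (ν : Fin d → ℤ) :
    quasiPeriodic ω F (fun i => ψ i + 2 * Real.pi * (ν i : ℝ)) = quasiPeriodic ω F ψ := by
  ext t
  exact (congrArg F (add_assoc (t • ω) ψ _).symm).trans (hF (t • ω + ψ) ν)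

theorem TorusAnalytic.analyticAt_quasiPeriodic (hF : TorusAnalytic F) (ω ψ : Fin d → ℝ) :
    AnalyticAt ℝ (quasiPeriodic ω F) ψ := by
  obtain ⟨M, hM0, hM⟩ := hF.exists_forall_hasCauchyBound
  exact ((pullback _).analyticAt _).comp (analyticAt_shift hF.1.contDiff hM hM0 ψ)

theorem TorusAnalytic.hasSum_quasiPeriodic (hF : TorusAnalytic F) (ω ψ : Fin d → ℝ) :
    HasSum (fun ν => trigMode (freqDot ω ν)
        (torusFourierCoeff F ν * Complex.exp (Complex.I * (freqDot ψ ν : ℂ))))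
      (quasiPeriodic ω F ψ) := by
  have hs := hF.summable_norm_torusFourierCoeff
  have hsum : Summable fun ν => trigMode (freqDot ω ν)
      (torusFourierCoeff F ν * Complex.exp (Complex.I * (freqDot ψ ν : ℂ))) := by
    refine hs.of_norm_bounded fun ν => ?_
    refine ((trigMode _).le_of_opNorm_le (norm_trigMode_le _) _).trans_eq ?_
    rw [one_mul, norm_mul, mul_comm Complex.I, Complex.norm_exp_ofReal_mul_I, mul_one]
  convert! hsum.hasSum using 1
  ext t
  have h := Complex.hasSum_re
    (hasSum_torusFourierCoeff hF.2 F.continuous hs.of_norm (t • ω + ψ))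
  refine h.unique ((hsum.hasSum.mapL (BoundedContinuousFunction.evalCLM ℝ t)).congr_fun fun ν => ?_)
  rw [freqDot_add_left, freqDot_smul_left, BoundedContinuousFunction.evalCLM_apply, trigMode_apply,
    mul_assoc, ← Complex.exp_add]
  congr 3
  push_cast
  ring

theorem TorusAnalytic.mean_quasiPeriodic_zero (hF : TorusAnalytic F) (ω : Fin d → ℝ) :
    mean (quasiPeriodic ω F 0) = meanValue F ω := by
  have h := (hF.hasSum_quasiPeriodic ω 0).mapL mean
  have hres := Complex.hasSum_re ((hasSum_subtype_iff_indicator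
      (s := {ν : Fin d → ℤ | freqDot ω ν = 0})).1
    (hF.summable_norm_torusFourierCoeff.of_norm.subtype _).hasSum)
  refine h.unique (hres.congr_fun fun ν => ?_)
  have h0 : freqDot 0 ν = 0 := by simp [freqDot]
  simp only [mean_trigMode, h0, indicator_apply, mem_ofPred_eq, Complex.ofReal_zero, mul_zero,
    Complex.exp_zero, mul_one, apply_ite Complex.re, Complex.zero_re]

end Fourier

section SmallForcing

theorem norm_oscillatorResponse_fluctuation_trigMode_le {l₁ l₂ : ℝ} (hl₁ : l₁ ≠ 0) (hl₂ : l₂ ≠ 0)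
    (b : ℝ) : ‖oscillatorResponse l₁ l₂ ∘L fluctuation ∘L trigMode b‖ ≤ 2 * |b|⁻¹ / |l₂| := by
  refine ContinuousLinearMap.opNorm_le_bound _ (by positivity) fun c => ?_
  simp only [ContinuousLinearMap.comp_apply]
  rcases eq_or_ne b 0 with rfl | hb
  · rw [trigMode_zero, map_smul, fluctuation_one, smul_zero, map_zero, norm_zero]
    positivity
  · have hderiv := hasDerivAt_trigMode_div hb c
    rw [fluctuation_deriv hderiv]
    refine (norm_oscillatorResponse_deriv_le hl₁ hl₂ hderiv).trans ?_
    have hnorm : ‖trigMode b (c / (Complex.I * b))‖ ≤ |b|⁻¹ * ‖c‖ := by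
      refine ((trigMode b).le_of_opNorm_le (norm_trigMode_le b) _).trans_eq ?_
      rw [one_mul, norm_div, norm_mul, Complex.norm_I, one_mul, Complex.norm_real,
        Real.norm_eq_abs, div_eq_inv_mul]
    rw [div_mul_eq_mul_div, mul_assoc]
    gcongr

variable {d : ℕ} {F : (Fin d → ℝ) →ᵇ ℝ}

/-- The sum over the modes of `F` of the sizes of their oscillator responses. -/
def modeResponseSum (ω : Fin d → ℝ) (F : (Fin d → ℝ) →ᵇ ℝ) (l₁ l₂ : ℝ) : ℝ :=
  ∑' ν, ‖oscillatorResponse l₁ l₂ ∘L fluctuation ∘L trigMode (freqDot ω ν)‖ *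
    ‖torusFourierCoeff F ν‖

theorem norm_oscillatorResponse_comp_le (l₁ l₂ b : ℝ) :
    ‖oscillatorResponse l₁ l₂ ∘L fluctuation ∘L trigMode b‖ ≤ |l₁ * l₂|⁻¹ * ‖fluctuation‖ := by
  refine (ContinuousLinearMap.opNorm_comp_le _ _).trans (mul_le_mul
    (norm_oscillatorResponse_le l₁ l₂) ?_ (norm_nonneg _) (by positivity))
  exact (ContinuousLinearMap.opNorm_comp_le _ _).trans
    (mul_le_of_le_one_right (norm_nonneg _) (norm_trigMode_le b))

theorem TorusAnalytic.norm_oscillatorResponse_fluctuation_quasiPeriodic_le (hF : TorusAnalytic F)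
    (ω ψ : Fin d → ℝ) (l₁ l₂ : ℝ) :
    ‖oscillatorResponse l₁ l₂ (fluctuation (quasiPeriodic ω F ψ))‖ ≤ modeResponseSum ω F l₁ l₂ := by
  have hsum := (hF.hasSum_quasiPeriodic ω ψ).mapL (oscillatorResponse l₁ l₂ ∘L fluctuation)
  refine hsum.norm_le_of_bounded (Summable.hasSum ?_) fun ν => ?_
  · exact Summable.of_nonneg_of_le (fun ν => by positivity)
      (fun ν => mul_le_mul_of_nonneg_right (norm_oscillatorResponse_comp_le l₁ l₂ _)
        (norm_nonneg _)) (hF.summable_norm_torusFourierCoeff.mul_left _)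
  · refine (ContinuousLinearMap.le_opNorm
      (oscillatorResponse l₁ l₂ ∘L fluctuation ∘L trigMode (freqDot ω ν)) _).trans_eq ?_
    rw [norm_mul, mul_comm Complex.I, Complex.norm_exp_ofReal_mul_I, mul_one]

theorem TorusAnalytic.tendsto_modeResponseSum (hF : TorusAnalytic F) (ω : Fin d → ℝ)
    {ι : Type*} {𝓕 : Filter ι} {l₁ l₂ : ι → ℝ} {a : ℝ} (ha : a ≠ 0)
    (hprod : ∀ᶠ i in 𝓕, l₁ i * l₂ i = a) (hl₂ : Tendsto (fun i => |l₂ i|) 𝓕 atTop) :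
    Tendsto (fun i => modeResponseSum ω F (l₁ i) (l₂ i)) 𝓕 (𝓝 0) := by
  have hmode (b : ℝ) : Tendsto
      (fun i => ‖oscillatorResponse (l₁ i) (l₂ i) ∘L fluctuation ∘L trigMode b‖) 𝓕 (𝓝 0) := by
    refine squeeze_zero' (Eventually.of_forall fun i => ContinuousLinearMap.opNorm_nonneg _) ?_
      (hl₂.const_div_atTop (2 * |b|⁻¹))
    filter_upwards [hprod] with i hi
    have hne : l₁ i * l₂ i ≠ 0 := hi.symm ▸ ha
    exact norm_oscillatorResponse_fluctuation_trigMode_le (left_ne_zero_of_mul hne)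
      (right_ne_zero_of_mul hne) b
  have h := tendsto_tsum_of_dominated_convergence
    (hF.summable_norm_torusFourierCoeff.mul_left (|a|⁻¹ * ‖fluctuation‖))
    (fun ν => (hmode (freqDot ω ν)).mul_const ‖torusFourierCoeff F ν‖) (by
      filter_upwards [hprod] with i hi ν
      rw [Real.norm_of_nonneg (by positivity), ← hi]
      exact mul_le_mul_of_nonneg_right (norm_oscillatorResponse_comp_le _ _ _) (norm_nonneg _))
  simpa only [modeResponseSum, zero_mul, tsum_zero] using h

end SmallForcing

section Roots

/-- The root of `ε l² + l + ε a` that tends to `0` with `ε`. -/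
def slowRoot (a ε : ℝ) : ℝ := -(2 * a * ε) / (1 + √(1 - 4 * a * ε ^ 2))

/-- The root of `ε l² + l + ε a` that tends to infinity as `ε` tends to `0`. -/
def fastRoot (a ε : ℝ) : ℝ := -(1 + √(1 - 4 * a * ε ^ 2)) / (2 * ε)

variable {a ε : ℝ}

theorem slowRoot_mul_fastRoot (a : ℝ) (hε : ε ≠ 0) : slowRoot a ε * fastRoot a ε = a := by
  have : 1 + √(1 - 4 * a * ε ^ 2) ≠ 0 := by positivity
  unfold slowRoot fastRoot
  field_simp

theorem slowRoot_add_fastRoot (hε : ε ≠ 0) (h : 4 * a * ε ^ 2 ≤ 1) :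
    slowRoot a ε + fastRoot a ε = -1 / ε := by
  have h0 : 1 + √(1 - 4 * a * ε ^ 2) ≠ 0 := by positivity
  have hs := Real.sq_sqrt (sub_nonneg.2 h)
  unfold slowRoot fastRoot
  generalize √(1 - 4 * a * ε ^ 2) = s at h0 hs ⊢
  field_simp
  linear_combination -hs

theorem abs_slowRoot_le (a ε : ℝ) : |slowRoot a ε| ≤ 2 * |a| * |ε| := by
  rw [slowRoot, abs_div, abs_neg, abs_mul, abs_mul, abs_two]
  refine div_le_self (by positivity) ((le_abs_self _).trans' ?_)
  linarith [Real.sqrt_nonneg (1 - 4 * a * ε ^ 2)]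

theorem inv_le_abs_fastRoot (a ε : ℝ) : (2 * |ε|)⁻¹ ≤ |fastRoot a ε| := by
  rw [fastRoot, abs_div, abs_neg, abs_mul, abs_two, inv_eq_one_div]
  refine div_le_div_of_nonneg_right ((le_abs_self _).trans' ?_) (by positivity)
  linarith [Real.sqrt_nonneg (1 - 4 * a * ε ^ 2)]

theorem tendsto_abs_fastRoot (a : ℝ) : Tendsto (fun ε => |fastRoot a ε|) (𝓝[≠] 0) atTop := by
  refine tendsto_atTop_mono (inv_le_abs_fastRoot a) (tendsto_inv_nhdsGT_zero.comp ?_)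
  refine tendsto_nhdsWithin_iff.2 ⟨?_, eventually_mem_nhdsWithin.mono fun ε hε => ?_⟩
  · exact ((continuous_abs.const_mul 2).tendsto' 0 0 (by simp)).mono_left nhdsWithin_le_nhds
  · exact mul_pos two_pos (abs_pos.2 hε)

theorem slowRoot_neg (ha : 0 < a) (hε : 0 < ε) : slowRoot a ε < 0 := by
  rw [slowRoot, neg_div]
  exact neg_neg_of_pos (by positivity)

theorem fastRoot_neg (hε : 0 < ε) : fastRoot a ε < 0 := by
  rw [fastRoot, neg_div]
  exact neg_neg_of_pos (by positivity)

end Roots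

section Remainder

theorem exists_lipschitzWith_remainder {g : ℝ → ℝ} {c : ℝ} (hg : AnalyticAt ℝ g c)
    {κ : NNReal} (hκ : 0 < κ) :
    ∃ (N : ℝ → ℝ) (p : FormalMultilinearSeries ℝ ℝ ℝ) (R : NNReal), LipschitzWith κ N ∧
      HasFPowerSeriesOnBall N p 0 R ∧ ∀ y : ℝ, |y| < R → g (c + y) = g c + deriv g c * y + N y := by
  let m : ℝ → ℝ := fun y => g (c + y) - g c - deriv g c * y
  have hg0 : AnalyticAt ℝ g (c + 0) := (add_zero c).symm ▸ hg
  have hm : AnalyticAt ℝ m 0 :=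
    ((hg0.comp (f := fun y => c + y) (analyticAt_const.add analyticAt_id)).sub
      analyticAt_const).sub (analyticAt_const.mul analyticAt_id)
  have hderiv : deriv m 0 = 0 := by
    have h := ((hg0.differentiableAt.hasDerivAt.comp_const_add c 0).sub_const (g c)).sub
      ((hasDerivAt_id (0 : ℝ)).const_mul (deriv g c))
    rw [add_zero, mul_one, sub_self] at h
    exact h.deriv
  obtain ⟨s, hs, hlip⟩ := hm.hasStrictDerivAt.hasStrictFDerivAt.exists_lipschitzOnWith_of_nnnorm_lt
    κ (by simpa [hderiv] using hκ)
  obtain ⟨N, hN, hEq⟩ := hlip.extend_real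
  obtain ⟨p, r, hp⟩ := hm
  obtain ⟨δ, hδ, hball⟩ := Metric.nhds_basis_eball.mem_iff.1 hs
  obtain ⟨R, hR0, hR⟩ := ENNReal.lt_iff_exists_nnreal_btwn.1 (lt_min hp.r_pos hδ)
  have hsub : Metric.eball 0 R ⊆ s :=
    (Metric.eball_subset_eball (hR.le.trans (min_le_right _ _))).trans hball
  refine ⟨N, p, R, hN,
    (hp.mono hR0 (hR.le.trans (min_le_left _ _))).congr (hEq.mono hsub), fun y hy => ?_⟩
  rw [← hEq (hsub (by rwa [Metric.eball_coe, mem_ball_zero_iff]))]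
  ring

end Remainder

section NonlinearResponse

variable {l₁ l₂ : ℝ} {N : ℝ → ℝ} {κ : NNReal}

/-- The homeomorphism `y ↦ y + oscillatorResponse l₁ l₂ (N ∘ y)` of the bounded continuous
functions. Its inverse turns the response to a forcing of the linear oscillator into the response
of the oscillator with the additional force `-N`. -/
def oscillatorHomeomorph (hN : LipschitzWith κ N) (hK : ‖oscillatorResponse l₁ l₂‖₊ * κ < 1) :
    (ℝ →ᵇ ℝ) ≃ₜ (ℝ →ᵇ ℝ) :=
  idAddHomeomorph
    ((oscillatorResponse l₁ l₂).lipschitz.comp (BoundedContinuousFunction.lipschitz_comp hN)) hK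

variable (hN : LipschitzWith κ N) (hK : ‖oscillatorResponse l₁ l₂‖₊ * κ < 1)

theorem oscillatorHomeomorph_apply (y : ℝ →ᵇ ℝ) :
    oscillatorHomeomorph hN hK y = y + oscillatorResponse l₁ l₂ (y.comp N hN) :=
  idAddHomeomorph_apply _ hK y

theorem oscillatorHomeomorph_shift (hl₁ : l₁ ≠ 0) (hl₂ : l₂ ≠ 0) (s : ℝ) (y : ℝ →ᵇ ℝ) :
    oscillatorHomeomorph hN hK (shift s y) = shift s (oscillatorHomeomorph hN hK y) := by
  rw [oscillatorHomeomorph_apply, oscillatorHomeomorph_apply, map_add,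
    ← oscillatorResponse_shift hl₁ hl₂]
  rfl

theorem oscillatorHomeomorph_symm_shift (hl₁ : l₁ ≠ 0) (hl₂ : l₂ ≠ 0) (s : ℝ) (y : ℝ →ᵇ ℝ) :
    (oscillatorHomeomorph hN hK).symm (shift s y) =
      shift s ((oscillatorHomeomorph hN hK).symm y) := by
  rw [Homeomorph.symm_apply_eq, oscillatorHomeomorph_shift hN hK hl₁ hl₂,
    Homeomorph.apply_symm_apply]

theorem norm_oscillatorHomeomorph_symm_le (h0 : N 0 = 0) (q : ℝ →ᵇ ℝ) :
    ‖(oscillatorHomeomorph hN hK).symm q‖ ≤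
      ‖q‖ / (1 - (‖oscillatorResponse l₁ l₂‖₊ * κ : NNReal)) := by
  refine norm_idAddHomeomorph_symm_le _ hK ?_ q
  have h : (0 : ℝ →ᵇ ℝ).comp N hN = 0 := BoundedContinuousFunction.ext fun _ => h0
  rw [Function.comp_apply, h, map_zero]

theorem oscillatorHomeomorph_symm_eq (h : ℝ →ᵇ ℝ) :
    (oscillatorHomeomorph hN hK).symm (oscillatorResponse l₁ l₂ h) = oscillatorResponse l₁ l₂
      (h - ((oscillatorHomeomorph hN hK).symm (oscillatorResponse l₁ l₂ h)).comp N hN) := by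
  rw [map_sub, eq_sub_iff_add_eq]
  exact (oscillatorHomeomorph hN hK).apply_symm_apply _

theorem analyticAt_oscillatorHomeomorph_symm {p : FormalMultilinearSeries ℝ ℝ ℝ} {R : NNReal}
    (hp : HasFPowerSeriesOnBall N p 0 R) {q : ℝ →ᵇ ℝ}
    (hq : ‖(oscillatorHomeomorph hN hK).symm q‖ < R) :
    AnalyticAt ℝ (oscillatorHomeomorph hN hK).symm q := by
  refine analyticAt_idAddHomeomorph_symm _ hK (((oscillatorResponse l₁ l₂).analyticAt _).comp ?_)
  refine (hasFPowerSeriesOnBall_comp hN hp).analyticAt_of_mem ?_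
  rwa [Metric.eball_coe, mem_ball_zero_iff]

theorem eq_oscillatorHomeomorph_symm {h y w : ℝ →ᵇ ℝ} (hl₁ : l₁ ≠ 0) (hl₂ : l₂ ≠ 0)
    (hy : SolvesOscillatorOn l₁ l₂ (fun t => h t - N (y t)) univ y w) :
    y = (oscillatorHomeomorph hN hK).symm (oscillatorResponse l₁ l₂ h) := by
  rw [← Homeomorph.symm_apply_eq, Homeomorph.symm_symm, oscillatorHomeomorph_apply,
    ← eq_sub_iff_add_eq, ← map_sub]
  exact SolvesOscillatorOn.eq_oscillatorResponse hl₁ hl₂ (h := h - y.comp N hN) hy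

end NonlinearResponse

section TorusResponse

variable {d : ℕ} {F : (Fin d → ℝ) →ᵇ ℝ} {l₁ l₂ : ℝ} {N : ℝ → ℝ} {κ : NNReal}

/-- The function on the torus whose restriction to the line `t • ω` is the quasi-periodic response
of the oscillator with the additional force `-N` to the fluctuation of `t ↦ F (t • ω)`. -/
def torusResponse (ω : Fin d → ℝ) (F : (Fin d → ℝ) →ᵇ ℝ) (hN : LipschitzWith κ N)
    (hK : ‖oscillatorResponse l₁ l₂‖₊ * κ < 1) (ψ : Fin d → ℝ) : ℝ :=
  (oscillatorHomeomorph hN hK).symm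
    (oscillatorResponse l₁ l₂ (fluctuation (quasiPeriodic ω F ψ))) 0

variable (ω : Fin d → ℝ) (hN : LipschitzWith κ N) (hK : ‖oscillatorResponse l₁ l₂‖₊ * κ < 1)

theorem torusResponse_smul (hl₁ : l₁ ≠ 0) (hl₂ : l₂ ≠ 0) (t : ℝ) :
    torusResponse ω F hN hK (t • ω) = (oscillatorHomeomorph hN hK).symm
      (oscillatorResponse l₁ l₂ (fluctuation (quasiPeriodic ω F 0))) t := by
  rw [torusResponse, quasiPeriodic_smul, fluctuation_shift, oscillatorResponse_shift hl₁ hl₂,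
    oscillatorHomeomorph_symm_shift hN hK hl₁ hl₂, shift_apply, zero_add]

theorem TorusAnalytic.norm_oscillatorHomeomorph_symm_quasiPeriodic_le (hF : TorusAnalytic F)
    (h0 : N 0 = 0) (ψ : Fin d → ℝ) :
    ‖(oscillatorHomeomorph hN hK).symm
      (oscillatorResponse l₁ l₂ (fluctuation (quasiPeriodic ω F ψ)))‖ ≤
      modeResponseSum ω F l₁ l₂ / (1 - (‖oscillatorResponse l₁ l₂‖₊ * κ : NNReal)) := by
  refine (norm_oscillatorHomeomorph_symm_le hN hK h0 _).trans ?_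
  have hK' : (0 : ℝ) ≤ 1 - (‖oscillatorResponse l₁ l₂‖₊ * κ : NNReal) :=
    sub_nonneg.2 (by exact_mod_cast hK.le)
  exact div_le_div_of_nonneg_right
    (hF.norm_oscillatorResponse_fluctuation_quasiPeriodic_le ω ψ l₁ l₂) hK'

theorem torusAnalytic_torusResponse (hF : TorusAnalytic F)
    {p : FormalMultilinearSeries ℝ ℝ ℝ} {R : NNReal} (hp : HasFPowerSeriesOnBall N p 0 R)
    (h0 : N 0 = 0)
    (hB : modeResponseSum ω F l₁ l₂ / (1 - (‖oscillatorResponse l₁ l₂‖₊ * κ : NNReal)) < R) :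
    TorusAnalytic (torusResponse ω F hN hK) := by
  refine ⟨fun ψ _ => ?_, fun ψ ν => ?_⟩
  · have hsymm := analyticAt_oscillatorHomeomorph_symm hN hK hp
      ((hF.norm_oscillatorHomeomorph_symm_quasiPeriodic_le ω hN hK h0 ψ).trans_lt hB)
    have hforcing : AnalyticAt ℝ
        (fun ψ => oscillatorResponse l₁ l₂ (fluctuation (quasiPeriodic ω F ψ))) ψ :=
      ((oscillatorResponse l₁ l₂ ∘L fluctuation).analyticAt _).comp
        (hF.analyticAt_quasiPeriodic ω ψ)
    exact ((BoundedContinuousFunction.evalCLM ℝ (0 : ℝ)).analyticAt _).comp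
      (hsymm.comp (f := fun ψ => oscillatorResponse l₁ l₂ (fluctuation (quasiPeriodic ω F ψ)))
        hforcing)
  · rw [torusResponse, hF.2.quasiPeriodic_add ω ψ ν, torusResponse]

end TorusResponse

section Decay

theorem exp_mul_abs_le_add_div {l μ C t₀ t₁ : ℝ} {y z : ℝ → ℝ} (hl : l + μ < 0)
    (hy : ∀ t ∈ Icc t₀ t₁, HasDerivWithinAt y (l * y t + z t) (Icc t₀ t₁) t)
    (hz : ∀ t ∈ Icc t₀ t₁, Real.exp (μ * (t - t₀)) * |z t| ≤ C) {t : ℝ} (ht : t ∈ Icc t₀ t₁) :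
    Real.exp (μ * (t - t₀)) * |y t| ≤ |y t₀| + C / -(l + μ) := by
  have hexp (s : ℝ) : HasDerivAt (fun s => Real.exp (μ * (s - t₀)))
      (Real.exp (μ * (s - t₀)) * (μ * 1)) s :=
    (((hasDerivAt_id s).sub_const t₀).const_mul μ).exp
  have h := abs_le_exp_mul_add_div (y := fun s => Real.exp (μ * (s - t₀)) * y s)
    (z := fun s => Real.exp (μ * (s - t₀)) * z s) hl
    (fun s hs => ((hexp s).hasDerivWithinAt.mul (hy s hs)).congr_deriv (by ring))
    (fun s hs => by simpa only [abs_mul, Real.abs_exp] using hz s hs) ht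
  rw [abs_mul, Real.abs_exp, sub_self, mul_zero, Real.exp_zero, one_mul] at h
  have hdecay : Real.exp ((l + μ) * (t - t₀)) ≤ 1 :=
    Real.exp_le_one_iff.2 (mul_nonpos_of_nonpos_of_nonneg hl.le (sub_nonneg.2 ht.1))
  linarith [mul_le_of_le_one_left (abs_nonneg (y t₀)) hdecay]

variable {l₁ l₂ t₀ t₁ : ℝ} {h y w : ℝ → ℝ}

theorem neg_mul_le_of_le_add_div {m b c : ℝ} (hl₁ : l₁ < 0) (hl : l₂ ≤ l₁) (hc : 0 ≤ c) (hm : 0 ≤ m)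
    (h : m ≤ b + (c + -l₂ * m / 4) / -(l₂ + -l₁ / 2)) : -l₂ * m ≤ 2 * -l₂ * b + 4 * c := by
  have hl₂ : 0 < -l₂ := by linarith
  have hdiv : (c + -l₂ * m / 4) / -(l₂ + -l₁ / 2) ≤ (c + -l₂ * m / 4) / (-l₂ / 2) :=
    div_le_div_of_nonneg_left (by positivity) (by linarith) (by linarith)
  have h' := h.trans (add_le_add_right hdiv b)
  rw [← sub_le_iff_le_add', le_div_iff₀ (by linarith)] at h'
  linarith

theorem SolvesOscillatorOn.exp_mul_abs_le {κ : ℝ} (hl₁ : l₁ < 0) (hl : l₂ ≤ l₁) (hκ0 : 0 ≤ κ)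
    (hκ : 8 * κ ≤ l₁ * l₂) (hy : SolvesOscillatorOn l₁ l₂ h (Icc t₀ t₁) y w)
    (hh : ∀ t ∈ Icc t₀ t₁, |h t| ≤ κ * |y t|) {t : ℝ} (ht : t ∈ Icc t₀ t₁) :
    Real.exp (-l₁ / 2 * (t - t₀)) * |y t| ≤ 6 * |y t₀| + 4 * |w t₀| / -l₂ ∧
      Real.exp (-l₁ / 2 * (t - t₀)) * |w t| ≤ 9 * -l₂ * |y t₀| + 6 * |w t₀| := by
  have hsys := solvesOscillatorOn_iff.1 hy
  let E : ℝ → ℝ := fun s => Real.exp (-l₁ / 2 * (s - t₀))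
  have hE (s : ℝ) : 0 < E s := Real.exp_pos _
  obtain ⟨s, hs, hmax⟩ := isCompact_Icc.exists_isMaxOn (f := fun s => E s * |y s|) ⟨t, ht⟩
    (ContinuousOn.mul (by fun_prop) (HasDerivWithinAt.continuousOn fun s hs => (hsys s hs).1).abs)
  set m := E s * |y s|
  have hm (u : ℝ) (hu : u ∈ Icc t₀ t₁) : E u * |y u| ≤ m := hmax hu
  have hκm : κ * m / -(l₁ + -l₁ / 2) ≤ -l₂ * m / 4 := by
    rw [div_le_iff₀ (by linarith)]
    nlinarith [show 0 ≤ m by positivity]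
  have hz (u : ℝ) (hu : u ∈ Icc t₀ t₁) :
      E u * |w u - l₂ * y u| ≤ |w t₀ - l₂ * y t₀| + -l₂ * m / 4 := by
    refine (exp_mul_abs_le_add_div (by linarith) (fun s hs => (hsys s hs).2) (fun u hu => ?_)
      hu).trans (add_le_add_right hκm _)
    calc E u * |h u| ≤ E u * (κ * |y u|) := mul_le_mul_of_nonneg_left (hh u hu) (hE u).le
      _ = κ * (E u * |y u|) := by ring
      _ ≤ κ * m := mul_le_mul_of_nonneg_left (hm u hu) hκ0
  have hl₂ : 0 < -l₂ := by linarith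
  have hms : -l₂ * m ≤ 2 * -l₂ * |y t₀| + 4 * |w t₀ - l₂ * y t₀| :=
    neg_mul_le_of_le_add_div hl₁ hl (abs_nonneg _) (by positivity)
      (exp_mul_abs_le_add_div (by linarith) (fun s hs => (hsys s hs).1) hz hs)
  have hz0 : |w t₀ - l₂ * y t₀| ≤ |w t₀| + -l₂ * |y t₀| := by
    rw [← abs_of_pos hl₂, ← abs_mul, neg_mul, abs_neg]
    exact abs_sub _ _
  have hw : |w t| ≤ |w t - l₂ * y t| + -l₂ * |y t| := by
    rw [← abs_of_pos hl₂, ← abs_mul, neg_mul, abs_neg]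
    exact (sub_add_cancel (w t) (l₂ * y t) ▸ abs_add_le _ _ :)
  constructor
  · refine (hm t ht).trans ?_
    rw [← sub_le_iff_le_add', le_div_iff₀ hl₂]
    linarith
  · have hEw := mul_le_mul_of_nonneg_left hw (hE t).le
    linarith [hz t ht, mul_le_mul_of_nonneg_left (hm t ht) hl₂.le,
      mul_nonneg hl₂.le (abs_nonneg (y t₀))]

end Decay

section InitialValue

/-- The bounded continuous function equal to `exp (-|l| * (t - t₀))` for `t ≥ t₀` and constant
for `t ≤ t₀`. -/
def expDecay (l t₀ : ℝ) : ℝ →ᵇ ℝ :=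
  .ofNormedAddCommGroup (fun t => Real.exp (-|l| * (max t t₀ - t₀))) (by fun_prop) 1 fun t => by
    rw [Real.norm_eq_abs, Real.abs_exp, Real.exp_le_one_iff]
    exact mul_nonpos_of_nonpos_of_nonneg (neg_nonpos.2 (abs_nonneg l))
      (sub_nonneg.2 (le_max_right t t₀))

theorem norm_expDecay_le (l t₀ : ℝ) : ‖expDecay l t₀‖ ≤ 1 :=
  BoundedContinuousFunction.norm_ofNormedAddCommGroup_le _ zero_le_one _

/-- The solution of `y' = l y + h` with value `y₀` at `t₀` for `t ≥ t₀`, continued as a constant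
for `t ≤ t₀`. -/
def initialValueSolution (l t₀ y₀ : ℝ) (h : ℝ →ᵇ ℝ) : ℝ →ᵇ ℝ :=
  pullback ⟨fun t => max t t₀, by fun_prop⟩ (derivResolvent l h) +
    (y₀ - derivResolvent l h t₀) • expDecay l t₀

variable {l t₀ y₀ : ℝ}

theorem initialValueSolution_apply_self (h : ℝ →ᵇ ℝ) : initialValueSolution l t₀ y₀ h t₀ = y₀ := by
  simp [initialValueSolution, expDecay, pullback_apply]

theorem hasDerivWithinAt_initialValueSolution (hl : l < 0) (h : ℝ →ᵇ ℝ) {t : ℝ} (ht : t ∈ Ici t₀) :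
    HasDerivWithinAt (initialValueSolution l t₀ y₀ h) (l * initialValueSolution l t₀ y₀ h t + h t)
      (Ici t₀) t := by
  have heq (s : ℝ) (hs : s ∈ Ici t₀) : initialValueSolution l t₀ y₀ h s =
      derivResolvent l h s + (y₀ - derivResolvent l h t₀) * Real.exp (l * (s - t₀)) := by
    simp [initialValueSolution, expDecay, pullback_apply, max_eq_left (mem_Ici.1 hs), abs_of_neg hl]
  have hexp : HasDerivAt (fun s => Real.exp (l * (s - t₀))) (Real.exp (l * (t - t₀)) * (l * 1)) t :=
    (((hasDerivAt_id t).sub_const t₀).const_mul l).exp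
  refine HasDerivWithinAt.congr ?_ heq (heq t ht)
  refine ((hasDerivAt_derivResolvent hl.ne h t).add (hexp.const_mul _)).hasDerivWithinAt.congr_deriv
    ?_
  rw [heq t ht]
  ring

theorem dist_initialValueSolution_le (h k : ℝ →ᵇ ℝ) :
    dist (initialValueSolution l t₀ y₀ h) (initialValueSolution l t₀ y₀ k) ≤
      2 * |l|⁻¹ * dist h k := by
  set u := derivResolvent l (h - k) with hu
  have hsub : initialValueSolution l t₀ y₀ h - initialValueSolution l t₀ y₀ k =
      pullback ⟨fun t => max t t₀, by fun_prop⟩ u - u t₀ • expDecay l t₀ := by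
    rw [hu, map_sub, map_sub, BoundedContinuousFunction.sub_apply, initialValueSolution,
      initialValueSolution]
    module
  have hu_le : ‖u‖ ≤ |l|⁻¹ * dist h k :=
    ((derivResolvent l).le_of_opNorm_le (norm_derivResolvent_le l) _).trans_eq
      (by rw [dist_eq_norm])
  have hpull : ‖pullback ⟨fun t => max t t₀, by fun_prop⟩ u‖ ≤ ‖u‖ :=
    (BoundedContinuousFunction.norm_le (norm_nonneg _)).2 fun t => u.norm_coe_le_norm _
  have hsmul : ‖u t₀ • expDecay l t₀‖ ≤ ‖u‖ := by
    rw [norm_smul]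
    exact (mul_le_of_le_one_right (norm_nonneg _) (norm_expDecay_le l t₀)).trans
      (u.norm_coe_le_norm t₀)
  rw [dist_eq_norm, hsub]
  linarith [norm_sub_le (pullback ⟨fun t => max t t₀, by fun_prop⟩ u) (u t₀ • expDecay l t₀)]

variable {l₁ l₂ : ℝ} {N : ℝ → ℝ} {κ : NNReal}

theorem contractingWith_initialValueSolution (hl₁ : l₁ < 0) (hl₂ : l₂ < 0)
    (hN : LipschitzWith κ N) (hκ : 8 * κ ≤ l₁ * l₂) (h : ℝ →ᵇ ℝ) (t₀ y₀ z₀ : ℝ) :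
    ContractingWith (1 / 2) fun y : ℝ →ᵇ ℝ =>
      initialValueSolution l₂ t₀ y₀ (initialValueSolution l₁ t₀ z₀ (h - y.comp N hN)) := by
  refine ⟨by norm_num, LipschitzWith.of_dist_le_mul fun y y' => ?_⟩
  have hcomp := (BoundedContinuousFunction.lipschitz_comp hN).dist_le_mul y y'
  refine (dist_initialValueSolution_le _ _).trans ((mul_le_mul_of_nonneg_left
    (dist_initialValueSolution_le _ _) (by positivity)).trans ?_)
  calc 2 * |l₂|⁻¹ * (2 * |l₁|⁻¹ * dist (h - y.comp N hN) (h - y'.comp N hN))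
      ≤ 2 * |l₂|⁻¹ * (2 * |l₁|⁻¹ * (κ * dist y y')) := by
        rw [dist_sub_left]
        gcongr
    _ = 4 * κ / (l₁ * l₂) * dist y y' := by
        rw [abs_of_neg hl₁, abs_of_neg hl₂]
        field_simp
        ring
    _ ≤ (1 / 2 : NNReal) * dist y y' := by
        refine mul_le_mul_of_nonneg_right ?_ dist_nonneg
        rw [div_le_iff₀ (mul_pos_of_neg_of_neg hl₁ hl₂)]
        push_cast
        linarith

theorem exists_solvesOscillatorOn_Ici (hl₁ : l₁ < 0) (hl₂ : l₂ < 0) (hN : LipschitzWith κ N)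
    (hκ : 8 * κ ≤ l₁ * l₂) (h : ℝ →ᵇ ℝ) (t₀ y₀ w₀ : ℝ) :
    ∃ y w : ℝ → ℝ, SolvesOscillatorOn l₁ l₂ (fun t => h t - N (y t)) (Ici t₀) y w ∧
      y t₀ = y₀ ∧ w t₀ = w₀ := by
  have hcontr := contractingWith_initialValueSolution hl₁ hl₂ hN hκ h t₀ y₀ (w₀ - l₂ * y₀)
  obtain ⟨y, hy⟩ : ∃ y : ℝ →ᵇ ℝ, initialValueSolution l₂ t₀ y₀
      (initialValueSolution l₁ t₀ (w₀ - l₂ * y₀) (h - y.comp N hN)) = y :=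
    ⟨_, hcontr.fixedPoint_isFixedPt⟩
  set z := initialValueSolution l₁ t₀ (w₀ - l₂ * y₀) (h - y.comp N hN) with hz
  have hy0 : y t₀ = y₀ := by rw [← hy, initialValueSolution_apply_self]
  refine ⟨y, fun t => z t + l₂ * y t, solvesOscillatorOn_iff.2 fun t ht => ?_, hy0, ?_⟩
  · simp only [add_sub_cancel_right]
    refine ⟨?_, hasDerivWithinAt_initialValueSolution hl₁ _ ht⟩
    have hderiv := hasDerivWithinAt_initialValueSolution (y₀ := y₀) hl₂ z ht
    rwa [hy] at hderiv
  · simp only [hy0, hz, initialValueSolution_apply_self, sub_add_cancel]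

end InitialValue

section NormalForm

/-- In the coordinate `y = x - c`, the equation `ε ẍ + ẋ + ε g(x) = ε h` is the oscillator equation
`(d/dt - l₁) (d/dt - l₂) y = h - g c - N y` as long as `|y| < R`. -/
structure IsOscillatorForm (ε : ℝ) (g : ℝ → ℝ) (c l₁ l₂ : ℝ) (N : ℝ → ℝ) (R : ℝ) : Prop where
  ne_zero : ε ≠ 0
  add_eq : l₁ + l₂ = -1 / ε
  expansion : ∀ y, |y| < R → g (c + y) = g c + l₁ * l₂ * y + N y

variable {d : ℕ} {ε : ℝ} {g : ℝ → ℝ} {f : (Fin d → ℝ) → ℝ} {ω : Fin d → ℝ} {J : Set ℝ}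
  {x v : ℝ → ℝ} {c l₁ l₂ R : ℝ} {N : ℝ → ℝ}

theorem IsOscillatorForm.isSolutionOn_iff (H : IsOscillatorForm ε g c l₁ l₂ N R)
    (hx : ∀ t ∈ J, |x t - c| < R) : IsSolutionOn ε g f ω J x v ↔
      SolvesOscillatorOn l₁ l₂ (fun t => f (t • ω) - g c - N (x t - c)) J (fun t => x t - c) v := by
  refine forall₂_congr fun t ht => and_congr ?_ ?_
  · exact (hasDerivWithinAt_sub_const_iff c).symm
  · have hg : g (x t) = g c + l₁ * l₂ * (x t - c) + N (x t - c) := by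
      rw [← H.expansion _ (hx t ht), add_sub_cancel]
    have hε := H.ne_zero
    have hacc (a : ℝ) : ε * a + v t + ε * g (x t) = ε * f (t • ω) ↔
        a = (l₁ + l₂) * v t - l₁ * l₂ * (x t - c) + (f (t • ω) - g c - N (x t - c)) := by
      rw [H.add_eq, hg, ← mul_right_inj' hε (b := a)]
      field_simp
      constructor <;> intro h <;> linarith
    simp only [hacc, exists_eq_right]

theorem isSolutionOn_mono {J' : Set ℝ} (hx : IsSolutionOn ε g f ω J x v) (hJ : J' ⊆ J) :
    IsSolutionOn ε g f ω J' x v := fun t ht =>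
  let ⟨hv, a, ha, heq⟩ := hx t (hJ ht)
  ⟨hv.mono hJ, a, ha.mono hJ, heq⟩

theorem eq_deriv_of_isSolutionOn_univ (hx : IsSolutionOn ε g f ω univ x v) : v = deriv x :=
  funext fun t => (hasDerivWithinAt_univ.1 (hx t trivial).1).deriv.symm

end NormalForm

section BoundedSolution

variable {d : ℕ} {ε : ℝ} {g : ℝ → ℝ} {F : (Fin d → ℝ) →ᵇ ℝ} {ω : Fin d → ℝ}
  {x v : ℝ → ℝ} {c l₁ l₂ ρ R : ℝ} {N : ℝ → ℝ} {κ : NNReal}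

theorem IsOscillatorForm.sub_const_eq (H : IsOscillatorForm ε g c l₁ l₂ N R) (hl₁ : l₁ ≠ 0)
    (hl₂ : l₂ ≠ 0) (hN : LipschitzWith κ N) (hK : ‖oscillatorResponse l₁ l₂‖₊ * κ < 1)
    (hρ : ρ ≤ R) (hx : IsSolutionOn ε g F ω univ x v) (hbox : ∀ t, |x t - c| < ρ ∧ |v t| < ρ) :
    (fun t => x t - c) = (oscillatorHomeomorph hN hK).symm (oscillatorResponse l₁ l₂
      (quasiPeriodic ω F 0 - BoundedContinuousFunction.const ℝ (g c))) := by
  have hsolves := (H.isSolutionOn_iff fun t _ => (hbox t).1.trans_le hρ).1 hx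
  obtain ⟨y, hy⟩ : ∃ y : ℝ →ᵇ ℝ, ⇑y = fun t => x t - c :=
    ⟨.ofNormedAddCommGroup _ (continuous_iff_continuousAt.2 fun t =>
      (hasDerivWithinAt_univ.1 (hsolves t trivial).1).continuousAt) ρ fun t => (hbox t).1.le, rfl⟩
  obtain ⟨w, hw⟩ : ∃ w : ℝ →ᵇ ℝ, ⇑w = v :=
    ⟨.ofNormedAddCommGroup _ (continuous_iff_continuousAt.2 fun t =>
      (hasDerivWithinAt_univ.1 (hsolves t trivial).2).continuousAt) ρ fun t => (hbox t).2.le, rfl⟩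
  rw [← hy, ← eq_oscillatorHomeomorph_symm hN hK hl₁ hl₂ (y := y) (w := w)]
  simpa [quasiPeriodic_apply, hy, hw] using hsolves

theorem IsOscillatorForm.uniqueInBox (H : IsOscillatorForm ε g c l₁ l₂ N R) (hl₁ : l₁ ≠ 0)
    (hl₂ : l₂ ≠ 0) (hN : LipschitzWith κ N) (hK : ‖oscillatorResponse l₁ l₂‖₊ * κ < 1)
    (hρ : ρ ≤ R) (hx : IsSolutionOn ε g F ω univ x (deriv x))
    (hbox : ∀ t, |x t - c| < ρ ∧ |deriv x t| < ρ) : UniqueInBox ε g F ω x c ρ := by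
  refine ⟨hbox, fun x' v' hx' hbox' => funext fun t => sub_left_injective (b := c) ?_⟩
  exact congrFun ((H.sub_const_eq hl₁ hl₂ hN hK hρ hx' hbox').trans
    (H.sub_const_eq hl₁ hl₂ hN hK hρ hx hbox).symm) t

theorem IsOscillatorForm.isSolutionOn_responseMotion (H : IsOscillatorForm ε g c l₁ l₂ N R)
    (hl₁ : l₁ ≠ 0) (hl₂ : l₂ ≠ 0) (hN : LipschitzWith κ N)
    (hK : ‖oscillatorResponse l₁ l₂‖₊ * κ < 1) (h0 : N 0 = 0)
    (hmean : g c = mean (quasiPeriodic ω F 0)) (hρ : ρ ≤ R)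
    (hy : ‖(oscillatorHomeomorph hN hK).symm
      (oscillatorResponse l₁ l₂ (fluctuation (quasiPeriodic ω F 0)))‖ < ρ) :
    ∃ w : ℝ →ᵇ ℝ, IsSolutionOn ε g F ω univ (responseMotion c (torusResponse ω F hN hK) ω) w ∧
      ‖w‖ ≤ |l₁| * ρ + (‖fluctuation (quasiPeriodic ω F 0)‖ + κ * ρ) / |l₂| := by
  set q := fluctuation (quasiPeriodic ω F 0) with hq
  set y := (oscillatorHomeomorph hN hK).symm (oscillatorResponse l₁ l₂ q) with hydef
  have hsub (t : ℝ) : responseMotion c (torusResponse ω F hN hK) ω t - c = y t := by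
    rw [responseMotion, torusResponse_smul ω hN hK hl₁ hl₂, add_sub_cancel_left]
  have hyt (t : ℝ) : |y t| < ρ := (y.norm_coe_le_norm t).trans_lt hy
  set k := q - y.comp N hN with hk
  have hsolves := solvesOscillatorOn_oscillatorResponse hl₁ hl₂ k
  rw [hk, ← oscillatorHomeomorph_symm_eq hN hK, ← hydef, ← hk] at hsolves
  have hforcing (t : ℝ) : k t = F (t • ω) - g c - N (y t) := by
    simp [hk, hq, hmean, fluctuation_apply, quasiPeriodic_apply]
  refine ⟨l₁ • y + derivResolvent l₂ k, (H.isSolutionOn_iff fun t _ => ?_).2 ?_, ?_⟩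
  · rw [hsub]
    exact (hyt t).trans_le hρ
  · simp only [hsub, ← hforcing]
    exact hsolves
  · have hcomp : ‖y.comp N hN‖ ≤ κ * ρ := by
      refine (BoundedContinuousFunction.norm_le
        (mul_nonneg κ.2 ((norm_nonneg y).trans hy.le))).2 fun t => ?_
      have hNy := hN.norm_sub_le (y t) 0
      rw [h0, sub_zero, sub_zero] at hNy
      exact hNy.trans (mul_le_mul_of_nonneg_left (hyt t).le κ.2)
    calc ‖l₁ • y + derivResolvent l₂ k‖ ≤ |l₁| * ‖y‖ + |l₂|⁻¹ * ‖k‖ :=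
          norm_add_le_of_le (norm_smul l₁ y).le
            ((derivResolvent l₂).le_of_opNorm_le (norm_derivResolvent_le l₂) k)
      _ ≤ |l₁| * ρ + |l₂|⁻¹ * (‖q‖ + κ * ρ) := by
          gcongr
          exact norm_sub_le_of_le le_rfl hcomp
      _ = |l₁| * ρ + (‖q‖ + κ * ρ) / |l₂| := by rw [inv_mul_eq_div]

end BoundedSolution

section Stability

theorem forall_lt_of_forall_Icc_lt {u : ℝ → ℝ} {a r R : ℝ} (hu : ContinuousOn u (Ici a))
    (hr : r < R) (ha : u a < R)
    (h : ∀ t ∈ Ici a, (∀ s ∈ Icc a t, u s < R) → u t ≤ r) {t : ℝ} (ht : t ∈ Ici a) : u t < R := by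
  by_contra! hlt
  have hcompact : IsCompact (Icc a t ∩ u ⁻¹' Ici R) :=
    isCompact_Icc.of_isClosed_subset
      ((hu.mono Icc_subset_Ici_self).preimage_isClosed_of_isClosed isClosed_Icc isClosed_Ici)
      inter_subset_left
  obtain ⟨s, ⟨hs, hRs⟩, hleast⟩ := hcompact.exists_isLeast ⟨t, right_mem_Icc.2 ht, hlt⟩
  have hne : a ≠ s := by
    rintro rfl
    exact ha.not_ge hRs
  have hbefore (x : ℝ) (hx : x ∈ Ico a s) : u x ≤ r := by
    refine h x hx.1 fun y hy => lt_of_not_ge fun hRy => ?_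
    exact (hy.2.trans_lt hx.2).not_ge (hleast ⟨⟨hy.1, (hy.2.trans hx.2.le).trans hs.2⟩, hRy⟩)
  have hus : u s ≤ r :=
    le_on_closure hbefore (hu.mono (closure_Ico hne ▸ Icc_subset_Ici_self)) continuousOn_const
      (closure_Ico hne ▸ right_mem_Icc.2 hs.1)
  exact (hus.trans_lt hr).not_ge hRs

theorem tendsto_zero_of_exp_mul_abs_le {u : ℝ → ℝ} {μ t₀ C : ℝ} (hμ : 0 < μ)
    (hu : ∀ t ∈ Ici t₀, Real.exp (μ * (t - t₀)) * |u t| ≤ C) : Tendsto u atTop (𝓝 0) := by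
  have hexp : Tendsto (fun t => C * Real.exp (-(μ * (t - t₀)))) atTop (𝓝 0) := by
    rw [← mul_zero C]
    exact (Real.tendsto_exp_neg_atTop_nhds_zero.comp
      ((tendsto_atTop_add_const_right _ (-t₀) tendsto_id).const_mul_atTop hμ)).const_mul C
  refine squeeze_zero_norm' ?_ hexp
  filter_upwards [Ici_mem_atTop t₀] with t ht
  rw [Real.exp_neg, ← div_eq_mul_inv, le_div_iff₀' (Real.exp_pos _)]
  exact hu t ht

variable {l₁ l₂ : ℝ} {N : ℝ → ℝ} {κ : NNReal}

theorem SolvesOscillatorOn.exp_mul_abs_sub_le {h y w y' w' : ℝ → ℝ} {t₀ t₁ : ℝ} (hl₁ : l₁ < 0)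
    (hl : l₂ ≤ l₁) (hN : LipschitzWith κ N) (hκ : 8 * κ ≤ l₁ * l₂)
    (hy : SolvesOscillatorOn l₁ l₂ (fun t => h t - N (y t)) (Icc t₀ t₁) y w)
    (hy' : SolvesOscillatorOn l₁ l₂ (fun t => h t - N (y' t)) (Icc t₀ t₁) y' w')
    {t : ℝ} (ht : t ∈ Icc t₀ t₁) :
    Real.exp (-l₁ / 2 * (t - t₀)) * |y t - y' t| ≤
        6 * |y t₀ - y' t₀| + 4 * |w t₀ - w' t₀| / -l₂ ∧
      Real.exp (-l₁ / 2 * (t - t₀)) * |w t - w' t| ≤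
        9 * -l₂ * |y t₀ - y' t₀| + 6 * |w t₀ - w' t₀| := by
  have hsub : SolvesOscillatorOn l₁ l₂ (fun t => N (y' t) - N (y t)) (Icc t₀ t₁)
      (fun t => y t - y' t) fun t => w t - w' t := fun s hs =>
    ⟨(hy s hs).1.sub (hy' s hs).1, ((hy s hs).2.sub (hy' s hs).2).congr_deriv (by ring)⟩
  refine hsub.exp_mul_abs_le hl₁ hl κ.2 hκ (fun s _ => ?_) ht
  rw [abs_sub_comm (y s)]
  exact hN.dist_le_mul (y' s) (y s)

theorem SolvesOscillatorOn.abs_le_of_abs_sub_lt {h y w y' w' : ℝ → ℝ} {t₀ t₁ ρ : ℝ} (hl₁ : l₁ < 0)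
    (hl : l₂ ≤ l₁) (hl₂ : l₂ ≤ -1) (hN : LipschitzWith κ N) (hκ : 8 * κ ≤ l₁ * l₂)
    (hy : SolvesOscillatorOn l₁ l₂ (fun t => h t - N (y t)) (Icc t₀ t₁) y w)
    (hy' : SolvesOscillatorOn l₁ l₂ (fun t => h t - N (y' t)) (Icc t₀ t₁) y' w')
    (hinit : |y t₀ - y' t₀| < 2 * ρ ∧ |w t₀ - w' t₀| < 2 * ρ) (hle : t₀ ≤ t₁)
    (hy'ρ : |y' t₁| < ρ) : |y t₁| ≤ 21 * ρ := by
  have hexp : 1 ≤ Real.exp (-l₁ / 2 * (t₁ - t₀)) :=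
    Real.one_le_exp (mul_nonneg (by linarith) (sub_nonneg.2 hle))
  have hsub := (le_mul_of_one_le_left (abs_nonneg _) hexp).trans
    (exp_mul_abs_sub_le hl₁ hl hN hκ hy hy' (right_mem_Icc.2 hle)).1
  have hdiv : 4 * |w t₀ - w' t₀| / -l₂ ≤ 4 * |w t₀ - w' t₀| :=
    div_le_self (by positivity) (by linarith)
  have htri := abs_sub_abs_le_abs_sub (y t₁) (y' t₁)
  linarith [hinit.1, hinit.2]

variable {d : ℕ} {ε : ℝ} {g : ℝ → ℝ} {f : (Fin d → ℝ) → ℝ} {ω : Fin d → ℝ}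
  {x₀ : ℝ → ℝ} {c ρ R : ℝ} (H : IsOscillatorForm ε g c l₁ l₂ N R) (hl₁ : l₁ < 0) (hl : l₂ ≤ l₁)
  (hl₂ : l₂ ≤ -1) (hN : LipschitzWith κ N) (hκ : 8 * κ ≤ l₁ * l₂) (hρ : 22 * ρ ≤ R)

include H hl₁ hl hl₂ hN hκ hρ

theorem IsOscillatorForm.abs_sub_lt
    (hx₀ : IsSolutionOn ε g f ω univ x₀ (deriv x₀))
    (hbox : ∀ t, |x₀ t - c| < ρ) {x v : ℝ → ℝ} {t₀ : ℝ} (hx : IsSolutionOn ε g f ω (Ici t₀) x v)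
    (hinit : |x t₀ - x₀ t₀| < 2 * ρ ∧ |v t₀ - deriv x₀ t₀| < 2 * ρ) {t : ℝ} (ht : t ∈ Ici t₀) :
    |x t - c| < R := by
  have hρ0 : 0 < ρ := (abs_nonneg _).trans_lt (hbox t₀)
  have hcont : ContinuousOn (fun t => |x t - c|) (Ici t₀) :=
    ((HasDerivWithinAt.continuousOn fun t ht => (hx t ht).1).sub continuousOn_const).abs
  refine forall_lt_of_forall_Icc_lt hcont (by linarith : 21 * ρ < R) ?_ (fun t ht hlt => ?_) ht
  · have htri := abs_sub_le (x t₀) (x₀ t₀) c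
    linarith [hinit.1, hbox t₀]
  · have hy := (H.isSolutionOn_iff hlt).1 (isSolutionOn_mono hx Icc_subset_Ici_self)
    have hy₀ := (H.isSolutionOn_iff (J := Icc t₀ t) fun s _ => (hbox s).trans (by linarith)).1
      (isSolutionOn_mono hx₀ (subset_univ _))
    refine hy.abs_le_of_abs_sub_lt (t₁ := t) hl₁ hl hl₂ hN hκ hy₀ ?_ ht (hbox t)
    simpa only [sub_sub_sub_cancel_right] using hinit

theorem IsOscillatorForm.exp_mul_abs_sub_le
    (hx₀ : IsSolutionOn ε g f ω univ x₀ (deriv x₀))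
    (hbox : ∀ t, |x₀ t - c| < ρ) {x v : ℝ → ℝ} {t₀ : ℝ} (hx : IsSolutionOn ε g f ω (Ici t₀) x v)
    (hinit : |x t₀ - x₀ t₀| < 2 * ρ ∧ |v t₀ - deriv x₀ t₀| < 2 * ρ) {t : ℝ} (ht : t ∈ Ici t₀) :
    Real.exp (-l₁ / 2 * (t - t₀)) * |x t - x₀ t| ≤
        6 * |x t₀ - x₀ t₀| + 4 * |v t₀ - deriv x₀ t₀| / -l₂ ∧
      Real.exp (-l₁ / 2 * (t - t₀)) * |v t - deriv x₀ t| ≤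
        9 * -l₂ * |x t₀ - x₀ t₀| + 6 * |v t₀ - deriv x₀ t₀| := by
  have hρ0 : 0 < ρ := (abs_nonneg _).trans_lt (hbox t₀)
  have hy := (H.isSolutionOn_iff (J := Icc t₀ t) fun s hs =>
    H.abs_sub_lt hl₁ hl hl₂ hN hκ hρ hx₀ hbox hx hinit hs.1).1
      (isSolutionOn_mono hx Icc_subset_Ici_self)
  have hy₀ := (H.isSolutionOn_iff (J := Icc t₀ t) fun s _ => (hbox s).trans (by linarith)).1
    (isSolutionOn_mono hx₀ (subset_univ _))
  simpa only [sub_sub_sub_cancel_right] using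
    hy.exp_mul_abs_sub_le hl₁ hl hN hκ hy₀ (right_mem_Icc.2 ht)

theorem IsOscillatorForm.isLyapunovStable
    (hx₀ : IsSolutionOn ε g f ω univ x₀ (deriv x₀))
    (hbox : ∀ t, |x₀ t - c| < ρ) : IsLyapunovStable ε g f ω x₀ := by
  intro η hη
  have hρ0 : 0 < ρ := (abs_nonneg _).trans_lt (hbox 0)
  have hl₂' : 0 < 15 * -l₂ := by linarith
  refine ⟨min (2 * ρ) (η / (15 * -l₂)), lt_min (by linarith) (by positivity), ?_⟩
  intro t₀ x v hx hpos hvel t ht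
  rw [lt_min_iff, lt_div_iff₀ hl₂'] at hpos hvel
  have hexp : 1 ≤ Real.exp (-l₁ / 2 * (t - t₀)) :=
    Real.one_le_exp (mul_nonneg (by linarith) (sub_nonneg.2 ht))
  obtain ⟨hxt, hvt⟩ := H.exp_mul_abs_sub_le hl₁ hl hl₂ hN hκ hρ hx₀ hbox hx ⟨hpos.1, hvel.1⟩ ht
  have hdiv : 4 * |v t₀ - deriv x₀ t₀| / -l₂ ≤ 4 * |v t₀ - deriv x₀ t₀| :=
    div_le_self (by positivity) (by linarith)
  have hscale (r : ℝ) : |r| ≤ |r| * -l₂ := le_mul_of_one_le_right (abs_nonneg r) (by linarith)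
  constructor
  · linarith [le_mul_of_one_le_left (abs_nonneg (x t - x₀ t)) hexp, hpos.2, hvel.2,
      hscale (x t₀ - x₀ t₀), hscale (v t₀ - deriv x₀ t₀)]
  · linarith [le_mul_of_one_le_left (abs_nonneg (v t - deriv x₀ t)) hexp, hpos.2, hvel.2,
      hscale (v t₀ - deriv x₀ t₀)]

theorem IsOscillatorForm.exists_isSolutionOn_Ici {F : (Fin d → ℝ) →ᵇ ℝ}
    (hx₀ : IsSolutionOn ε g F ω univ x₀ (deriv x₀))
    (hbox : ∀ t, |x₀ t - c| < ρ) {t₀ x₁ v₁ : ℝ}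
    (hinit : |x₁ - x₀ t₀| < 2 * ρ ∧ |v₁ - deriv x₀ t₀| < 2 * ρ) :
    ∃ x v : ℝ → ℝ, IsSolutionOn ε g F ω (Ici t₀) x v ∧ x t₀ = x₁ ∧ v t₀ = v₁ := by
  have hρ0 : 0 < ρ := (abs_nonneg _).trans_lt (hbox t₀)
  obtain ⟨y, w, hy, hy0, hw0⟩ := exists_solvesOscillatorOn_Ici hl₁ (by linarith) hN hκ
    (quasiPeriodic ω F 0 - BoundedContinuousFunction.const ℝ (g c)) t₀ (x₁ - c) v₁
  simp only [BoundedContinuousFunction.sub_apply, quasiPeriodic_apply, add_zero,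
    BoundedContinuousFunction.const_apply] at hy
  have hyR (t : ℝ) (ht : t ∈ Ici t₀) : |y t| < R := by
    have hy₀ := (H.isSolutionOn_iff (J := Icc t₀ t) fun s _ => (hbox s).trans (by linarith)).1
      (isSolutionOn_mono hx₀ (subset_univ _))
    refine ((hy.mono Icc_subset_Ici_self).abs_le_of_abs_sub_lt hl₁ hl hl₂ hN hκ hy₀ ?_ ht
      (hbox t)).trans_lt (by linarith)
    rwa [hy0, hw0, sub_sub_sub_cancel_right]
  refine ⟨fun t => c + y t, w, (H.isSolutionOn_iff ?_).2 ?_, ?_, hw0⟩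
  · simpa only [add_sub_cancel_left] using hyR
  · simpa only [add_sub_cancel_left] using hy
  · simp only [hy0, add_sub_cancel]

theorem IsOscillatorForm.attractsBox {F : (Fin d → ℝ) →ᵇ ℝ}
    (hx₀ : IsSolutionOn ε g F ω univ x₀ (deriv x₀))
    (hbox : ∀ t, |x₀ t - c| < ρ ∧ |deriv x₀ t| < ρ) : AttractsBox ε g F ω x₀ c ρ := by
  intro t₀ x₁ v₁ hx₁ hv₁
  have hinit : |x₁ - x₀ t₀| < 2 * ρ ∧ |v₁ - deriv x₀ t₀| < 2 * ρ := by
    have hpos := abs_sub_le x₁ c (x₀ t₀)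
    rw [abs_sub_comm c] at hpos
    have hvel := abs_sub v₁ (deriv x₀ t₀)
    constructor <;> linarith [(hbox t₀).1, (hbox t₀).2]
  have hpos (t : ℝ) := (hbox t).1
  refine ⟨H.exists_isSolutionOn_Ici hl₁ hl hl₂ hN hκ hρ hx₀ hpos hinit, ?_⟩
  rintro x v hx rfl rfl
  have hdecay (t : ℝ) (ht : t ∈ Ici t₀) :=
    H.exp_mul_abs_sub_le hl₁ hl hl₂ hN hκ hρ hx₀ hpos hx hinit ht
  have hμ : 0 < -l₁ / 2 := by linarith
  exact ⟨tendsto_zero_of_exp_mul_abs_le hμ fun t ht => (hdecay t ht).1,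
    tendsto_zero_of_exp_mul_abs_le hμ fun t ht => (hdecay t ht).2⟩

end Stability

section RootAsymptotics

variable {d : ℕ} {a : ℝ} {F : (Fin d → ℝ) →ᵇ ℝ} {κ : NNReal}

theorem slowRoot_mul_fastRoot_zero (a : ℝ) : slowRoot a 0 * fastRoot a 0 = 0 := by
  rw [fastRoot, mul_zero, div_zero, mul_zero]

theorem nnnorm_oscillatorResponse_roots_mul_le (hκ : 8 * κ ≤ ‖a‖₊) (ε : ℝ) :
    ‖oscillatorResponse (slowRoot a ε) (fastRoot a ε)‖₊ * κ ≤ 1 / 8 := by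
  have hM : ‖oscillatorResponse (slowRoot a ε) (fastRoot a ε)‖₊ ≤ ‖a‖₊⁻¹ := by
    refine (norm_oscillatorResponse_le _ _).trans ?_
    rcases eq_or_ne ε 0 with rfl | hε
    · rw [slowRoot_mul_fastRoot_zero, abs_zero, inv_zero]
      exact NNReal.coe_nonneg _
    · rw [slowRoot_mul_fastRoot a hε]
      exact le_rfl
  have hκ' : κ ≤ ‖a‖₊ / 8 := (le_div_iff₀' (by norm_num)).2 hκ
  calc ‖oscillatorResponse (slowRoot a ε) (fastRoot a ε)‖₊ * κ
      ≤ ‖a‖₊⁻¹ * (‖a‖₊ / 8) := mul_le_mul' hM hκ'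
    _ = ‖a‖₊⁻¹ * ‖a‖₊ / 8 := (mul_div_assoc _ _ _).symm
    _ ≤ 1 / 8 := by
      gcongr
      exact inv_mul_le_one

theorem modeResponseSum_eq_zero (ω : Fin d → ℝ) (F : (Fin d → ℝ) →ᵇ ℝ) {l₁ l₂ : ℝ}
    (h : l₁ * l₂ = 0) : modeResponseSum ω F l₁ l₂ = 0 := by
  refine (tsum_congr fun ν => mul_eq_zero_of_left ?_ _).trans tsum_zero
  refine le_antisymm ?_ (ContinuousLinearMap.opNorm_nonneg _)
  simpa only [h, abs_zero, inv_zero, zero_mul] using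
    norm_oscillatorResponse_comp_le l₁ l₂ (freqDot ω ν)

theorem TorusAnalytic.tendsto_modeResponseSum_roots (hF : TorusAnalytic F) (ω : Fin d → ℝ)
    (ha : a ≠ 0) :
    Tendsto (fun ε => modeResponseSum ω F (slowRoot a ε) (fastRoot a ε)) (𝓝 0) (𝓝 0) := by
  have hcont : ContinuousAt (fun ε => modeResponseSum ω F (slowRoot a ε) (fastRoot a ε)) 0 := by
    rw [continuousAt_iff_punctured_nhds, modeResponseSum_eq_zero ω F (slowRoot_mul_fastRoot_zero a)]
    exact hF.tendsto_modeResponseSum ω ha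
      (eventually_nhdsWithin_of_forall fun ε hε => slowRoot_mul_fastRoot a hε)
      (tendsto_abs_fastRoot a)
  simpa only [ContinuousAt, modeResponseSum_eq_zero ω F (slowRoot_mul_fastRoot_zero a)] using hcont

/-- The a priori bound for the response of the oscillator with roots `slowRoot a ε`, `fastRoot a ε`
and an additional `κ`-Lipschitz force to the fluctuation of `t ↦ F (t • ω)`. -/
def responseBound (ω : Fin d → ℝ) (F : (Fin d → ℝ) →ᵇ ℝ) (a : ℝ) (κ : NNReal) (ε : ℝ) : ℝ :=
  modeResponseSum ω F (slowRoot a ε) (fastRoot a ε) /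
    (1 - (‖oscillatorResponse (slowRoot a ε) (fastRoot a ε)‖₊ * κ : NNReal))

theorem TorusAnalytic.tendsto_responseBound (hF : TorusAnalytic F) (ω : Fin d → ℝ) (ha : a ≠ 0)
    (hκ : 8 * κ ≤ ‖a‖₊) : Tendsto (responseBound ω F a κ) (𝓝 0) (𝓝 0) := by
  have hden (ε : ℝ) : (1 / 2 : ℝ) ≤
      1 - (‖oscillatorResponse (slowRoot a ε) (fastRoot a ε)‖₊ * κ : NNReal) := by
    have h := NNReal.coe_le_coe.2 (nnnorm_oscillatorResponse_roots_mul_le hκ ε)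
    push_cast at h ⊢
    linarith
  have hnonneg (ε : ℝ) : 0 ≤ modeResponseSum ω F (slowRoot a ε) (fastRoot a ε) :=
    tsum_nonneg fun ν => mul_nonneg (ContinuousLinearMap.opNorm_nonneg _) (norm_nonneg _)
  refine squeeze_zero (fun ε => div_nonneg (hnonneg ε) ((hden ε).trans' (by norm_num)))
    (fun ε => div_le_div_of_nonneg_left (hnonneg ε) (by norm_num) (hden ε)) ?_
  simpa using (hF.tendsto_modeResponseSum_roots ω ha).div_const (1 / 2 : ℝ)

theorem eventually_roots (a C : ℝ) {ρ : ℝ} (hρ : 0 < ρ) :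
    ∀ᶠ ε in 𝓝[≠] 0, 4 * a * ε ^ 2 ≤ 1 ∧ |slowRoot a ε| ≤ 1 ∧ 1 ≤ |fastRoot a ε| ∧
      |slowRoot a ε| * ρ + C / |fastRoot a ε| < ρ := by
  have hslow : Tendsto (fun ε => |slowRoot a ε|) (𝓝[≠] 0) (𝓝 0) :=
    squeeze_zero (fun _ => abs_nonneg _) (abs_slowRoot_le a)
      (((continuous_abs.const_mul (2 * |a|)).tendsto' 0 0 (by simp)).mono_left nhdsWithin_le_nhds)
  have hfast := tendsto_abs_fastRoot a
  have hdisc : Tendsto (fun ε : ℝ => 4 * a * ε ^ 2) (𝓝[≠] 0) (𝓝 0) :=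
    (Continuous.tendsto' (by fun_prop) 0 0 (by simp)).mono_left nhdsWithin_le_nhds
  have hvel : Tendsto (fun ε => |slowRoot a ε| * ρ + C / |fastRoot a ε|) (𝓝[≠] 0) (𝓝 0) := by
    simpa using (hslow.mul_const ρ).add (hfast.const_div_atTop C)
  filter_upwards [hdisc.eventually_le_const one_pos, hslow.eventually_le_const one_pos,
    hfast.eventually_ge_atTop 1, hvel.eventually_lt_const hρ] with ε h₁ h₂ h₃ h₄
  exact ⟨h₁, h₂, h₃, h₄⟩

end RootAsymptotics

section Response

/-- Near `c` the function `g` is affine with slope `a ≠ 0` up to a remainder `N`, analytic on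
`|y| < R` and with a globally valid Lipschitz constant `κ` much smaller than `|a|`. -/
structure SmallRemainder (g : ℝ → ℝ) (c a : ℝ) (N : ℝ → ℝ) (κ R : NNReal) : Prop where
  slope_ne_zero : a ≠ 0
  lipschitz : LipschitzWith κ N
  le_slope : 8 * κ ≤ ‖a‖₊
  analytic : ∃ p : FormalMultilinearSeries ℝ ℝ ℝ, HasFPowerSeriesOnBall N p 0 R
  expansion : ∀ y : ℝ, |y| < R → g (c + y) = g c + a * y + N y

theorem exists_smallRemainder {g : ℝ → ℝ} {c : ℝ} (hg : AnalyticAt ℝ g c) (hc : deriv g c ≠ 0) :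
    ∃ N κ R, SmallRemainder g c (deriv g c) N κ R := by
  obtain ⟨N, p, R, hN, hp, hexp⟩ := exists_lipschitzWith_remainder hg
    (κ := ‖deriv g c‖₊ / 8) (div_pos (nnnorm_pos.2 hc) (by norm_num))
  exact ⟨N, _, R, hc, hN, (mul_div_cancel₀ _ (by norm_num)).le, ⟨p, hp⟩, hexp⟩

namespace SmallRemainder

variable {d : ℕ} {g N : ℝ → ℝ} {F : (Fin d → ℝ) →ᵇ ℝ} {ω : Fin d → ℝ} {c a ρ ε : ℝ} {κ R : NNReal}
  (S : SmallRemainder g c a N κ R)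

include S

theorem radius_pos : 0 < R :=
  let ⟨_, hp⟩ := S.analytic
  ENNReal.coe_pos.1 hp.r_pos

theorem apply_zero : N 0 = 0 := by
  simpa using S.expansion 0 (by simpa using S.radius_pos)

theorem nnnorm_mul_lt_one (ε : ℝ) :
    ‖oscillatorResponse (slowRoot a ε) (fastRoot a ε)‖₊ * κ < 1 :=
  (nnnorm_oscillatorResponse_roots_mul_le S.le_slope ε).trans_lt (by norm_num)

omit S in
/-- The function `X(·, ε)` on the torus: the oscillator response at the parameter `ε`. -/
def response (S : SmallRemainder g c a N κ R) (ω : Fin d → ℝ) (F : (Fin d → ℝ) →ᵇ ℝ) (ε : ℝ) :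
    (Fin d → ℝ) → ℝ :=
  torusResponse ω F S.lipschitz (S.nnnorm_mul_lt_one ε)

theorem abs_response_le (hF : TorusAnalytic F) (ε : ℝ) (ψ : Fin d → ℝ) :
    |S.response ω F ε ψ| ≤ responseBound ω F a κ ε :=
  (BoundedContinuousFunction.norm_coe_le_norm _ _).trans
    (hF.norm_oscillatorHomeomorph_symm_quasiPeriodic_le ω S.lipschitz (S.nnnorm_mul_lt_one ε)
      S.apply_zero ψ)

theorem torusAnalytic_response (hF : TorusAnalytic F) (hε : responseBound ω F a κ ε < R) :
    TorusAnalytic (S.response ω F ε) :=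
  let ⟨_, hp⟩ := S.analytic
  torusAnalytic_torusResponse ω S.lipschitz (S.nnnorm_mul_lt_one ε) hF hp S.apply_zero hε

theorem tendstoUniformly_response (hF : TorusAnalytic F) :
    TendstoUniformly (S.response ω F) (fun _ => 0) (𝓝 0) := by
  refine Metric.tendstoUniformly_iff.2 fun δ hδ => ?_
  filter_upwards [(hF.tendsto_responseBound ω S.slope_ne_zero S.le_slope).eventually_lt_const hδ]
    with ε hε ψ
  rw [dist_zero_left]
  exact (S.abs_response_le hF ε ψ).trans_lt hε

-- The junk value `fastRoot a 0 = 0` makes the response vanish at `ε = 0`, as it should.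
theorem isSolutionOn_zero (hF : TorusAnalytic F) :
    IsSolutionOn 0 g F ω univ (responseMotion c (S.response ω F 0) ω)
      (deriv (responseMotion c (S.response ω F 0) ω)) := by
  have hconst : responseMotion c (S.response ω F 0) ω = fun _ => c := by
    funext t
    have h := S.abs_response_le (ω := ω) hF 0 (t • ω)
    rw [responseBound, modeResponseSum_eq_zero ω F (slowRoot_mul_fastRoot_zero a), zero_div] at h
    rw [responseMotion, abs_nonpos_iff.1 h, add_zero]
  rw [hconst, deriv_const']
  exact fun t _ => ⟨hasDerivWithinAt_const .., 0, hasDerivWithinAt_const .., by simp⟩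

end SmallRemainder

end Response

section SmallParameter

/-- The conditions on `ε` under which the response motion lies in the box of size `ρ` and the
decay estimates apply. -/
structure IsSmallParameter {d : ℕ} (ω : Fin d → ℝ) (F : (Fin d → ℝ) →ᵇ ℝ) (a : ℝ) (κ : NNReal)
    (ρ ε : ℝ) : Prop where
  ne_zero : ε ≠ 0
  responseBound_lt : responseBound ω F a κ ε < ρ
  discriminant_nonneg : 4 * a * ε ^ 2 ≤ 1
  abs_slowRoot_le_one : |slowRoot a ε| ≤ 1
  one_le_abs_fastRoot : 1 ≤ |fastRoot a ε|
  velocityBound_lt : |slowRoot a ε| * ρ +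
    (‖fluctuation (quasiPeriodic ω F 0)‖ + κ * ρ) / |fastRoot a ε| < ρ

variable {d : ℕ} {g N : ℝ → ℝ} {F : (Fin d → ℝ) →ᵇ ℝ} {ω : Fin d → ℝ} {c a ρ ε : ℝ} {κ R : NNReal}

theorem TorusAnalytic.exists_pos_forall_isSmallParameter (hF : TorusAnalytic F) (ω : Fin d → ℝ)
    (ha : a ≠ 0) (hκ : 8 * κ ≤ ‖a‖₊) (hρ : 0 < ρ) :
    ∃ ε₀ > 0, ∀ ε : ℝ, |ε| < ε₀ →
      responseBound ω F a κ ε < ρ ∧ (ε ≠ 0 → IsSmallParameter ω F a κ ρ ε) := by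
  have hbound := (hF.tendsto_responseBound ω ha hκ).eventually_lt_const hρ
  obtain ⟨ε₀, hε₀, hsmall⟩ := Metric.eventually_nhds_iff.1 (hbound.and (eventually_nhdsWithin_iff.1
    (eventually_roots a (‖fluctuation (quasiPeriodic ω F 0)‖ + κ * ρ) hρ)))
  refine ⟨ε₀, hε₀, fun ε hε => ?_⟩
  obtain ⟨hlt, hroots⟩ := hsmall (by rwa [Real.dist_0_eq_abs])
  refine ⟨hlt, fun hε0 => ?_⟩
  obtain ⟨hdisc, hslow, hfast, hvel⟩ := hroots hε0
  exact ⟨hε0, hlt, hdisc, hslow, hfast, hvel⟩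

namespace IsSmallParameter

variable (P : IsSmallParameter ω F a κ ρ ε) (S : SmallRemainder g c a N κ R)

include P S

theorem isOscillatorForm : IsOscillatorForm ε g c (slowRoot a ε) (fastRoot a ε) N R :=
  ⟨P.ne_zero, slowRoot_add_fastRoot P.ne_zero P.discriminant_nonneg, by
    rw [slowRoot_mul_fastRoot a P.ne_zero]
    exact S.expansion⟩

theorem slowRoot_mul_fastRoot_ne_zero : slowRoot a ε * fastRoot a ε ≠ 0 :=
  (slowRoot_mul_fastRoot a P.ne_zero).symm ▸ S.slope_ne_zero

theorem isSolutionOn_and_mem_box (hF : TorusAnalytic F) (hmean : g c = meanValue F ω)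
    (hρ : ρ ≤ R) :
    IsSolutionOn ε g F ω univ (responseMotion c (S.response ω F ε) ω)
        (deriv (responseMotion c (S.response ω F ε) ω)) ∧
      ∀ t, |responseMotion c (S.response ω F ε) ω t - c| < ρ ∧
        |deriv (responseMotion c (S.response ω F ε) ω) t| < ρ := by
  have hne := P.slowRoot_mul_fastRoot_ne_zero S
  obtain ⟨w, hw, hwle⟩ := (P.isOscillatorForm S).isSolutionOn_responseMotion
    (left_ne_zero_of_mul hne) (right_ne_zero_of_mul hne) S.lipschitz (S.nnnorm_mul_lt_one ε)
    S.apply_zero (hmean.trans (hF.mean_quasiPeriodic_zero ω).symm) hρ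
    ((hF.norm_oscillatorHomeomorph_symm_quasiPeriodic_le ω S.lipschitz (S.nnnorm_mul_lt_one ε)
      S.apply_zero 0).trans_lt P.responseBound_lt)
  rw [SmallRemainder.response, ← eq_deriv_of_isSolutionOn_univ hw]
  refine ⟨hw, fun t => ⟨?_, (w.norm_coe_le_norm t).trans_lt (hwle.trans_lt P.velocityBound_lt)⟩⟩
  rw [responseMotion, add_sub_cancel_left]
  exact (S.abs_response_le hF ε _).trans_lt P.responseBound_lt

theorem uniqueInBox (hF : TorusAnalytic F) (hmean : g c = meanValue F ω) (hρ : ρ ≤ R) :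
    UniqueInBox ε g F ω (responseMotion c (S.response ω F ε) ω) c ρ :=
  have ⟨hsol, hbox⟩ := P.isSolutionOn_and_mem_box S hF hmean hρ
  have hne := P.slowRoot_mul_fastRoot_ne_zero S
  (P.isOscillatorForm S).uniqueInBox (left_ne_zero_of_mul hne) (right_ne_zero_of_mul hne)
    S.lipschitz (S.nnnorm_mul_lt_one ε) hρ hsol hbox

theorem isLyapunovStable_and_attractsBox (hF : TorusAnalytic F) (hmean : g c = meanValue F ω)
    (hρR : 22 * ρ ≤ R) (ha : 0 < a) (hε : 0 < ε) :
    IsLyapunovStable ε g F ω (responseMotion c (S.response ω F ε) ω) ∧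
      AttractsBox ε g F ω (responseMotion c (S.response ω F ε) ω) c ρ := by
  obtain ⟨hsol, hbox⟩ := P.isSolutionOn_and_mem_box S hF hmean (by linarith [R.coe_nonneg])
  have hslow : slowRoot a ε < 0 := slowRoot_neg ha hε
  have hfast : fastRoot a ε ≤ -1 :=
    le_neg_of_le_neg ((abs_of_neg (fastRoot_neg hε)) ▸ P.one_le_abs_fastRoot)
  have hle : fastRoot a ε ≤ slowRoot a ε := hfast.trans (abs_le.1 P.abs_slowRoot_le_one).1
  have hκ : 8 * (κ : ℝ) ≤ slowRoot a ε * fastRoot a ε := by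
    rw [slowRoot_mul_fastRoot a hε.ne', ← Real.norm_of_nonneg ha.le]
    exact_mod_cast S.le_slope
  have H := P.isOscillatorForm S
  exact ⟨H.isLyapunovStable hslow hle hfast S.lipschitz hκ hρR hsol fun t => (hbox t).1,
    H.attractsBox hslow hle hfast S.lipschitz hκ hρR hsol hbox⟩

end IsSmallParameter

end SmallParameter

theorem theorem1_general (d : ℕ) (g : ℝ → ℝ) (f : (Fin d → ℝ) → ℝ) (ω : Fin d → ℝ) (c₀ : ℝ)
    (hg : AnalyticAt ℝ g c₀) (hf : TorusAnalytic f)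
    (hc₀ : IsSimpleZero (fun x => g x - meanValue f ω) c₀) :
    ∃ ε₀ > 0, ∃ X : ℝ → (Fin d → ℝ) → ℝ,
      (∀ ε : ℝ, |ε| < ε₀ →
        TorusAnalytic (X ε) ∧
        IsSolutionOn ε g f ω Set.univ
          (responseMotion c₀ (X ε) ω) (deriv (responseMotion c₀ (X ε) ω))) ∧
      TendstoUniformly X (fun _ => 0) (𝓝 0) ∧
      ∃ ρ > 0,
        (0 < deriv g c₀ → ∀ ε : ℝ, 0 < ε → ε < ε₀ →
          IsLyapunovStable ε g f ω (responseMotion c₀ (X ε) ω) ∧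
          AttractsBox ε g f ω (responseMotion c₀ (X ε) ω) c₀ ρ) ∧
        (∀ ε : ℝ, ε ≠ 0 → |ε| < ε₀ →
          UniqueInBox ε g f ω (responseMotion c₀ (X ε) ω) c₀ ρ) := by
  obtain ⟨F, rfl⟩ := hf.2.exists_boundedContinuousFunction hf.1.continuous
  obtain ⟨hmean, hslope⟩ := hc₀
  rw [sub_eq_zero] at hmean
  rw [deriv_sub_const] at hslope
  obtain ⟨N, κ, R, S⟩ := exists_smallRemainder hg hslope
  have hR : (0 : ℝ) < R := S.radius_pos
  have hρ : (R / 22 : ℝ) ≤ R := by linarith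
  obtain ⟨ε₀, hε₀, hsmall⟩ := hf.exists_pos_forall_isSmallParameter ω hslope S.le_slope
    (show 0 < (R / 22 : ℝ) by positivity)
  refine ⟨ε₀, hε₀, S.response ω F, fun ε hε => ⟨?_, ?_⟩, S.tendstoUniformly_response hf,
    R / 22, by positivity, fun ha ε hε0 hε => ?_, fun ε hε0 hε => ?_⟩
  · exact S.torusAnalytic_response hf ((hsmall ε hε).1.trans_le hρ)
  · rcases eq_or_ne ε 0 with rfl | hε0
    · exact S.isSolutionOn_zero hf
    · exact (((hsmall ε hε).2 hε0).isSolutionOn_and_mem_box S hf hmean hρ).1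
  · have P := (hsmall ε ((abs_of_pos hε0).trans_lt hε)).2 hε0.ne'
    exact P.isLyapunovStable_and_attractsBox S hf hmean (by linarith) ha hε0
  · exact ((hsmall ε hε).2 hε0).uniqueInBox S hf hmean hρ

end

theorem theorem1 (d : ℕ) (g : ℝ → ℝ) (f : (Fin d → ℝ) → ℝ)
    (hg : AnalyticOnNhd ℝ g Set.univ) (hf : TorusAnalytic f)
    (ω : Fin d → ℝ) (c₀ : ℝ) (hc₀ : IsSimpleZero (fun x => g x - meanValue f ω) c₀) :
    ∃ ε₀ > 0, ∃ X : ℝ → (Fin d → ℝ) → ℝ,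
      (∀ ε : ℝ, |ε| < ε₀ →
        TorusAnalytic (X ε) ∧
        IsSolutionOn ε g f ω Set.univ
          (responseMotion c₀ (X ε) ω) (deriv (responseMotion c₀ (X ε) ω))) ∧
      TendstoUniformly X (fun _ => 0) (𝓝 0) ∧
      (0 < deriv g c₀ →
        ∃ ρ > 0,
          (∀ ε : ℝ, 0 < ε → ε < ε₀ →
            IsLyapunovStable ε g f ω (responseMotion c₀ (X ε) ω) ∧
            AttractsBox ε g f ω (responseMotion c₀ (X ε) ω) c₀ ρ) ∧
          (∀ ε : ℝ, ε ≠ 0 → |ε| < ε₀ →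
            UniqueInBox ε g f ω (responseMotion c₀ (X ε) ω) c₀ ρ)) := by
  obtain ⟨ε₀, hε₀, X, hX, hlim, ρ, hρ, hattr, hunique⟩ :=
    theorem1_general d g f ω c₀ (hg c₀ (mem_univ c₀)) hf hc₀
  exact ⟨ε₀, hε₀, X, hX, hlim, fun ha => ⟨ρ, hρ, hattr ha, hunique⟩⟩
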